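/- Let $d,n\ge 1$ and $m_1,\dots,m_n$ be integers, let $\Omega\subset\mathbb R^d$ be a bounded open set, and let $M_i\in\mathbb R^{m_i\times d}$ ($1\le i\le n$) be non-degenerate, i.e. $M_i^Tz\ne 0$ for every $z\in\mathbb Z^{m_i}\setminus\{0\}$. Let $\varepsilon$ run through a sequence tending to $0$ and let $\varepsilon_1,\dots,\varepsilon_n>0$ be scales depending on $\varepsilon$ that are separated: $$\lim_{\varepsilon\to0}\varepsilon_1=0,\qquad \lim_{\varepsilon\to0}\frac{\varepsilon_{i+1}}{\varepsilon_i}=0\quad(1\le i\le n-1).$$ Write $\mathbb T^m=\mathbb R^m/\mathbb Z^m$ and $\mathbb T=\mathbb T^{m_1}\times\cdots\times\mathbb T^{m_n}$. All functions are scalar- or vector-valued over a fixed field, $\mathbb R$ or $\mathbb C$. A family $v_\varepsilon\in L^2(\Omega)$ is said to converge to $v_0\in L^2(\Omega\times\mathbb T)$ in the multiscale cut-and-project sense if $$\lim_{\varepsilon\to0}\int_\Omega v_\varepsilon(x)\,\psi\Big(x,\frac{M_1x}{\varepsilon_1},\dots,\frac{M_nx}{\varepsilon_n}\Big)dx=\int_\Omega\int_{\mathbb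 T}v_0(x,y)\,\psi(x,y)\,dy\,dx\qquad\text{for all }\psi\in L^2(\Omega;C(\mathbb T));$$ for vector-valued functions the convergence is meant componentwise. For $1\le\ell\le n$ let $\mathcal L_\ell$ be the set of all $w\in L^2(\Omega\times\mathbb T)^d$ that can be written as a series converging in $L^2$, $$w(x,y)=\sum_{\substack{k_i\in\mathbb Z^{m_i},\,1\le i\le\ell\\ k_\ell\neq0}}\lambda(k_1,\dots,k_\ell;x)\,M_\ell^Tk_\ell\,\exp\Big(2\pi\mathbf i\sum_{1\le j\le\ell}k_j\cdot y_j\Big),$$ with scalar (complex) functions $\lambda(k_1,\dots,k_\ell;\cdot)\in L^2(\Omega)$. Let $\{u_\varepsilon\}$ be a bounded sequence in $H^1_0(\Omega)$. Then there are $u_0\in L^2(\Omega)$ with weak gradient $\nabla u_0\in L^2(\Omega)^d$ and $U_i\in\mathcal L_i$ ($1\le i\le n$) such that, along a subsequence, $$u_\varepsilon\longrightarrow u_0,\qquad \nabla u_\varepsilon\longrightarrow\nabla u_0+\sum_{i=1}^nU_i$$ in the multiscale cut-and-project sense, where $u_0$ is regarded as a function on $\Omega\times\mathbb T$ that depends on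 $x$ only. -/

import Mathlib

open MeasureTheory Filter Topology TopologicalSpace
open scoped ENNReal NNReal Matrix

namespace CutProject

/-- `ℝ^d` with its Euclidean norm. -/
abbrev Space (d : ℕ) : Type := EuclideanSpace ℝ (Fin d)

/-- Vectors with `d` entries in `𝕜` and the Euclidean norm. -/
abbrev Vec (𝕜 : Type*) (d : ℕ) : Type _ := EuclideanSpace 𝕜 (Fin d)

/-- The product torus `𝕋^{m_1} × ⋯ × 𝕋^{m_n}`: the variable `y_i` is `fun j => y ⟨i, j⟩`. -/
abbrev Torus {n : ℕ} (m : Fin n → ℕ) : Type := UnitAddTorus (Σ i : Fin n, Fin (m i))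

/-- The frequencies `(k_1, …, k_n) ∈ ℤ^{m_1} × ⋯ × ℤ^{m_n}`. -/
abbrev Freq {n : ℕ} (m : Fin n → ℕ) : Type := (Σ i : Fin n, Fin (m i)) → ℤ

/-- The measure `dy_1 ⋯ dy_n` on the torus, of total mass one. -/
noncomputable def torusMeasure {n : ℕ} (m : Fin n → ℕ) : Measure (Torus m) :=
  Measure.pi fun _ => AddCircle.haarAddCircle

/-- The measure `dx dy_1 ⋯ dy_n` on `Ω × 𝕋^{m_1} × ⋯ × 𝕋^{m_n}`. -/
noncomputable def prodMeasure {d n : ℕ} (Ω : Opens (Space d)) (m : Fin n → ℕ) :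
    Measure (Space d × Torus m) :=
  (volume.restrict (Ω : Set (Space d))).prod (torusMeasure m)

/-! ### Sobolev spaces -/

/-- The classical gradient of a differentiable function. -/
noncomputable def grad {𝕜 : Type*} [RCLike 𝕜] {d : ℕ} (φ : Space d → 𝕜) (x : Space d) :
    Vec 𝕜 d :=
  WithLp.toLp 2 fun a => fderiv ℝ φ x (EuclideanSpace.single a 1)

/-- `G` is the gradient of `u` on `Ω` in the sense of distributions
(`TestFunction Ω 𝕜 ⊤` is the space `C_c^∞(Ω)`). -/
def HasWeakGradient {𝕜 : Type*} [RCLike 𝕜] {d : ℕ} (Ω : Opens (Space d))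
    (u : Space d → 𝕜) (G : Space d → Vec 𝕜 d) : Prop :=
  ∀ (φ : TestFunction Ω 𝕜 ⊤) (a : Fin d),
    ∫ x in (Ω : Set (Space d)), u x * grad φ x a = -∫ x in (Ω : Set (Space d)), G x a * φ x

/-- `u ∈ H¹(Ω)`, and `G` is (a representative of) its weak gradient. -/
structure MemH1 {𝕜 : Type*} [RCLike 𝕜] {d : ℕ} (Ω : Opens (Space d))
    (u : Space d → 𝕜) (G : Space d → Vec 𝕜 d) : Prop where
  memLp : MemLp u 2 (volume.restrict (Ω : Set (Space d)))
  memLp_grad : MemLp G 2 (volume.restrict (Ω : Set (Space d)))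
  hasWeakGradient : HasWeakGradient Ω u G

/-- The norm of `H¹(Ω)`, in the form `‖u‖_{L²(Ω)} + ‖∇u‖_{L²(Ω)}`. -/
noncomputable def h1Norm {𝕜 : Type*} [RCLike 𝕜] {d : ℕ} (Ω : Opens (Space d))
    (u : Space d → 𝕜) (G : Space d → Vec 𝕜 d) : ℝ≥0∞ :=
  eLpNorm u 2 (volume.restrict (Ω : Set (Space d))) +
    eLpNorm G 2 (volume.restrict (Ω : Set (Space d)))

/-- `u ∈ H¹₀(Ω)`, the closure of `C_c^∞(Ω)` in `H¹(Ω)`, and `G` is its weak gradient. -/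
structure MemH10 {𝕜 : Type*} [RCLike 𝕜] {d : ℕ} (Ω : Opens (Space d))
    (u : Space d → 𝕜) (G : Space d → Vec 𝕜 d) : Prop extends MemH1 Ω u G where
  exists_approx : ∃ φ : ℕ → TestFunction Ω 𝕜 ⊤,
    Tendsto (fun k => h1Norm Ω (fun x => u x - φ k x) (fun x => G x - grad (φ k) x))
      atTop (𝓝 0)

/-! ### Matrices and scales -/

/-- `Mᵀ z ≠ 0` for every nonzero integer vector `z`. -/
def NonDegenerate {p d : ℕ} (M : Matrix (Fin p) (Fin d) ℝ) : Prop :=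
  ∀ z : Fin p → ℤ, z ≠ 0 → Mᵀ *ᵥ (fun j => (z j : ℝ)) ≠ 0

/-- A sequence of positive scales `(ε_1, …, ε_n)` with `ε_1 → 0` and `ε_{i+1} / ε_i → 0`. -/
structure ScaleSeparated {n : ℕ} [NeZero n] (ε : ℕ → Fin n → ℝ) : Prop where
  pos : ∀ k i, 0 < ε k i
  first : Tendsto (fun k => ε k 0) atTop (𝓝 0)
  ratio : ∀ i j : Fin n, (i : ℕ) + 1 = j → Tendsto (fun k => ε k j / ε k i) atTop (𝓝 0)

/-- The point `(M_1 x / e_1, …, M_n x / e_n)` of the torus. -/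
noncomputable def cutProj {d n : ℕ} {m : Fin n → ℕ} (M : ∀ i, Matrix (Fin (m i)) (Fin d) ℝ)
    (e : Fin n → ℝ) (x : Space d) : Torus m :=
  fun s => (((M s.1 *ᵥ x.ofLp) s.2 / e s.1 : ℝ) : UnitAddCircle)

/-! ### Multiscale cut-and-project convergence -/

/-- Multiscale cut-and-project convergence, along the scales `ε k`, of functions `v k` in `L²(Ω)`
to `v₀` in `L²(Ω × 𝕋^{m_1} × ⋯ × 𝕋^{m_n})`. The test functions `ψ` run through
`L²(Ω; C_per(𝕋^{m_1} × ⋯ × 𝕋^{m_n}))`, a Bochner space of functions with values in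
the Banach space of continuous functions on the torus. -/
structure MultiscaleConverges {𝕜 : Type*} [RCLike 𝕜] {d n : ℕ} {m : Fin n → ℕ}
    (Ω : Opens (Space d)) (M : ∀ i, Matrix (Fin (m i)) (Fin d) ℝ) (ε : ℕ → Fin n → ℝ)
    (v : ℕ → Space d → 𝕜) (v₀ : Space d × Torus m → 𝕜) : Prop where
  memLp_seq : ∀ k, MemLp (v k) 2 (volume.restrict (Ω : Set (Space d)))
  memLp_limit : MemLp v₀ 2 (prodMeasure Ω m)
  tendsto : ∀ ψ : Space d → C(Torus m, 𝕜),
    MemLp ψ 2 (volume.restrict (Ω : Set (Space d))) →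
      Tendsto (fun k => ∫ x in (Ω : Set (Space d)), v k x * ψ x (cutProj M (ε k) x)) atTop
        (𝓝 (∫ p, v₀ p * ψ p.1 p.2 ∂(prodMeasure Ω m)))

/-- The frequencies `(k_1, …, k_ℓ, 0, …, 0)` with `k_ℓ ≠ 0`. -/
abbrev FreqLevel {n : ℕ} (m : Fin n → ℕ) (ℓ : Fin n) : Type :=
  {k : Freq m // (∃ j, k ⟨ℓ, j⟩ ≠ 0) ∧ ∀ i, ℓ < i → ∀ j, k ⟨i, j⟩ = 0}

/-- The summand `c(x) M_ℓᵀ k_ℓ exp(2π𝐢 ∑_j k_j · y_j)`. -/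
noncomputable def fourierTerm {d n : ℕ} {m : Fin n → ℕ}
    (M : ∀ i, Matrix (Fin (m i)) (Fin d) ℝ) (ℓ : Fin n) (k : Freq m) (c : Space d → ℂ)
    (p : Space d × Torus m) : Vec ℂ d :=
  WithLp.toLp 2 fun a =>
    c p.1 * ((((M ℓ)ᵀ *ᵥ fun j => (k ⟨ℓ, j⟩ : ℝ)) a : ℝ) : ℂ) * UnitAddTorus.mFourier k p.2

/-- A `𝕜`-valued vector regarded as a complex vector. -/
noncomputable def toComplex {𝕜 : Type*} [RCLike 𝕜] {d : ℕ} (v : Vec 𝕜 d) : Vec ℂ d :=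
  WithLp.toLp 2 fun a => RCLike.map 𝕜 ℂ (v a)

/-- The space `𝓛_ℓ`: the `w` in `L²(Ω × 𝕋^{m_1} × ⋯ × 𝕋^{m_n})^d` which are the sum in `L²` of a
series `∑ c(k_1, …, k_ℓ; x) M_ℓᵀ k_ℓ exp(2π𝐢 ∑_{j ≤ ℓ} k_j · y_j)` over all `(k_1, …, k_ℓ)` with
`k_ℓ ≠ 0`, where the coefficients are scalar functions of `x`. -/
structure MemL {𝕜 : Type*} [RCLike 𝕜] {d n : ℕ} {m : Fin n → ℕ} (Ω : Opens (Space d))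
    (M : ∀ i, Matrix (Fin (m i)) (Fin d) ℝ) (ℓ : Fin n) (w : Space d × Torus m → Vec 𝕜 d) :
    Prop where
  memLp : MemLp w 2 (prodMeasure Ω m)
  exists_series : ∃ c : FreqLevel m ℓ → Space d → ℂ,
    (∀ k, MemLp (c k) 2 (volume.restrict (Ω : Set (Space d)))) ∧
      Tendsto (fun s : Finset (FreqLevel m ℓ) =>
        eLpNorm (fun p => toComplex (w p) - ∑ k ∈ s, fourierTerm M ℓ k.1 (c k) p) 2
          (prodMeasure Ω m)) atTop (𝓝 0)

end CutProject

/-! Fourier analysis in the torus variable turns the theorem into a statement about coefficients.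
For a frequency `k`, multiplication by `e_k(M₁x/ε₁, …, Mₙx/εₙ)` is an isometry of `L²(Ω)`, and this
factor is a plane wave with wave vector `ξ = ∑ᵢ Mᵢᵀkᵢ/εᵢ`. If `k ≠ 0` and `ℓ` is its last nonzero
level, scale separation gives `ε_ℓ ξ → M_ℓᵀk_ℓ ≠ 0`. Hence `|ξ| → ∞`, and by Riemann-Lebesgue
distinct frequencies become orthogonal in the limit (`tendsto_inner_oscillation`).

Weak compactness gives one subsequence along which all demodulated functions converge weakly.
Bessel's inequality makes the limits `c_k` square summable (`exists_subseq_coefficients`), so `∑ c_k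
⊗ e_k` exists in `L²(Ω × 𝕋)`. Convergence against every test function then follows from boundedness
and the density of trigonometric polynomials (`multiscaleConverges_of_tendsto_inner`).

The structure of the limits comes from testing the weak gradient with a test function times a plane
wave: `⟪E_k ∂ₐφ, u⟫ - 2πi ξₐ ⟪E_k φ, u⟫ = -⟪E_k φ, ∂ₐu⟫`, up to conjugating `φ`. Multiplied by
`ε_ℓ`, it forces the coefficients of `u` at `k ≠ 0` to vanish. Eliminating the term in `ξₐ ξₐ'`
between two directions shows that the gradient coefficient at `k` is parallel to `M_ℓᵀk_ℓ`. At `k =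
0` it is the weak gradient relation for `u₀`. Sorting nonzero frequencies by last level yields the
`U_ℓ`.

All this is done over `ℂ`; a general scalar field is embedded into `ℂ` and the limits are projected
back. -/

namespace CutProject

open scoped InnerProductSpace ComplexConjugate

/-! ### Weak compactness and Bessel's inequality in Hilbert space -/

section Hilbert

variable {H : Type*} [NormedAddCommGroup H] [InnerProductSpace ℂ H]

/-- A countable family of bounded sequences in a separable Hilbert space has a common weakly
convergent subsequence. -/
theorem exists_subseq_tendsto_inner [CompleteSpace H] [SeparableSpace H] {K : Type*} [Countable K]
    (x : ℕ → K → H) (C : ℝ) (hx : ∀ j k, ‖x j k‖ ≤ C) :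
    ∃ φ : ℕ → ℕ, StrictMono φ ∧ ∃ c : K → H, ∀ k h,
      Tendsto (fun j => ⟪h, x (φ j) k⟫_ℂ) atTop (𝓝 ⟪h, c k⟫_ℂ) := by
  set B : Set (WeakDual ℂ H) :=
    WeakDual.toStrongDual ⁻¹' Metric.closedBall (0 : StrongDual ℂ H) C with hB
  have hBc : IsCompact B := WeakDual.isCompact_closedBall 0 C
  have : CompactSpace B := isCompact_iff_compactSpace.mp hBc
  have : MetrizableSpace B := WeakDual.metrizable_of_isCompact ℂ H B hBc
  let y : ℕ → K → B := fun j k =>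
    ⟨StrongDual.toWeakDual (InnerProductSpace.toDual ℂ H (x j k)), by
      simpa [hB] using hx j k⟩
  -- A countable product of compact metrizable balls is sequentially compact, so one extraction
  -- serves every `k` and no diagonal argument is needed.
  obtain ⟨z, φ, hφ, hz⟩ := CompactSpace.tendsto_subseq y
  refine ⟨φ, hφ, fun k => (InnerProductSpace.toDual ℂ H).symm
    (WeakDual.toStrongDual (z k : WeakDual ℂ H)), fun k h => ?_⟩
  have h1 : Tendsto (fun j => ((y (φ j) k : WeakDual ℂ H)) h) atTop
      (𝓝 ((z k : WeakDual ℂ H) h)) :=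
    ((WeakDual.eval_continuous h).comp continuous_subtype_val).continuousAt.tendsto.comp
      (tendsto_pi_nhds.mp hz k)
  have h2 := (Complex.continuous_conj.tendsto _).comp h1
  convert h2 using 2
  · rw [← inner_conj_symm]
    rfl
  · rw [← inner_conj_symm, InnerProductSpace.toDual_symm_apply]
    rfl

/-- Bessel's inequality for weak limits along asymptotically orthogonal isometries. -/
theorem sum_norm_sq_le_of_tendsto_inner {K : Type*} (E : ℕ → K → H →ₗᵢ[ℂ] H)
    (hE : ∀ k l, k ≠ l → ∀ f g, Tendsto (fun j => ⟪E j k f, E j l g⟫_ℂ) atTop (𝓝 0))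
    (v : ℕ → H) (C : ℝ) (hv : ∀ j, ‖v j‖ ≤ C) (c : K → H)
    (hc : ∀ k f, Tendsto (fun j => ⟪E j k f, v j⟫_ℂ) atTop (𝓝 ⟪f, c k⟫_ℂ)) (s : Finset K) :
    ∑ k ∈ s, ‖c k‖ ^ 2 ≤ C ^ 2 := by
  classical
  set B : ℝ := ∑ k ∈ s, ‖c k‖ ^ 2 with hB
  have h1 : Tendsto (fun j => RCLike.re ⟪∑ k ∈ s, E j k (c k), v j⟫_ℂ) atTop (𝓝 B) := by
    have : Tendsto (fun j => ∑ k ∈ s, ⟪E j k (c k), v j⟫_ℂ) atTop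
        (𝓝 (∑ k ∈ s, ⟪c k, c k⟫_ℂ)) := tendsto_finsetSum _ fun k _ => hc k (c k)
    have h := (RCLike.continuous_re.tendsto _).comp this
    simp only [map_sum, inner_self_eq_norm_sq] at h
    refine h.congr fun j => ?_
    simp
  have h2 : Tendsto (fun j => RCLike.re ⟪∑ k ∈ s, E j k (c k), ∑ k ∈ s, E j k (c k)⟫_ℂ) atTop
      (𝓝 B) := by
    have : Tendsto (fun j => ∑ k ∈ s, ∑ l ∈ s, ⟪E j k (c k), E j l (c l)⟫_ℂ) atTop
        (𝓝 (∑ k ∈ s, ∑ l ∈ s, if k = l then ((‖c k‖ ^ 2 : ℝ) : ℂ) else 0)) := by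
      refine tendsto_finsetSum _ fun k _ => tendsto_finsetSum _ fun l _ => ?_
      split_ifs with h
      · subst h
        simp [inner_self_eq_norm_sq_to_K]
      · exact hE k l h _ _
    have h := (RCLike.continuous_re.tendsto _).comp this
    convert h using 2
    · rw [Function.comp_apply, sum_inner]
      simp only [inner_sum]
    · rw [hB]
      simp [-Complex.ofReal_pow]
  -- This is `0 ≤ ‖∑ E c - v‖²` expanded. Both inner products tend to `B`, so the limit reads `0 ≤
  -- C² - 2B + B`.
  have h3 : ∀ j, 0 ≤ C ^ 2 - 2 * RCLike.re ⟪∑ k ∈ s, E j k (c k), v j⟫_ℂ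
      + RCLike.re ⟪∑ k ∈ s, E j k (c k), ∑ k ∈ s, E j k (c k)⟫_ℂ := by
    intro j
    have h := norm_sub_sq (𝕜 := ℂ) (∑ k ∈ s, E j k (c k)) (v j)
    rw [inner_self_eq_norm_sq]
    have h4 : ‖v j‖ ^ 2 ≤ C ^ 2 := pow_le_pow_left₀ (norm_nonneg _) (hv j) 2
    nlinarith [sq_nonneg ‖∑ k ∈ s, E j k (c k) - v j‖]
  have h5 := ge_of_tendsto' ((tendsto_const_nhds.sub (h1.const_mul 2)).add h2) h3
  linarith

/-- Weak compactness of bounded sequences relative to asymptotically orthogonal isometries, with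
square summable limit coefficients. -/
theorem exists_subseq_coefficients [CompleteSpace H] [SeparableSpace H] {K ι : Type*}
    [Countable K] [Countable ι] (E : ℕ → K → H →ₗᵢ[ℂ] H)
    (hE : ∀ k l, k ≠ l → ∀ f g, Tendsto (fun j => ⟪E j k f, E j l g⟫_ℂ) atTop (𝓝 0))
    (v : ℕ → ι → H) (C : ℝ) (hv : ∀ j i, ‖v j i‖ ≤ C) :
    ∃ φ : ℕ → ℕ, StrictMono φ ∧ ∃ c : ι → K → H,
      (∀ i k f, Tendsto (fun j => ⟪E (φ j) k f, v (φ j) i⟫_ℂ) atTop (𝓝 ⟪f, c i k⟫_ℂ)) ∧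
      ∀ i, Summable fun k => ‖c i k‖ ^ 2 := by
  -- The adjoint of an isometry is a contraction, so the demodulated sequences keep the bound `C`.
  obtain ⟨φ, hφ, c, hc⟩ := exists_subseq_tendsto_inner
    (fun j (p : ι × K) => (E j p.2).toContinuousLinearMap.adjoint (v j p.1)) C (by
      intro j p
      refine ((ContinuousLinearMap.le_opNorm _ _).trans ?_).trans (hv j p.1)
      rw [LinearIsometryEquiv.norm_map]
      exact mul_le_of_le_one_left (norm_nonneg _)
        (LinearIsometry.norm_toContinuousLinearMap_le _))
  have hc' : ∀ i k f, Tendsto (fun j => ⟪E (φ j) k f, v (φ j) i⟫_ℂ) atTop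
      (𝓝 ⟪f, c (i, k)⟫_ℂ) := by
    intro i k f
    simpa [ContinuousLinearMap.adjoint_inner_right] using hc (i, k) f
  refine ⟨φ, hφ, fun i k => c (i, k), hc', fun i => ?_⟩
  refine summable_of_sum_le (c := C ^ 2) (fun k => by positivity) fun s => ?_
  exact sum_norm_sq_le_of_tendsto_inner (fun j => E (φ j))
    (fun k l hkl f g => (hE k l hkl f g).comp hφ.tendsto_atTop) (fun j => v (φ j) i) C
    (fun j => hv _ _) (fun k => c (i, k)) (hc' i) s

end Hilbert

/-! ### Isometries given by composition and unimodular multiplication -/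

section Twist

variable {α β : Type*} [MeasurableSpace α] [MeasurableSpace β] {ν : Measure α} {μ : Measure β}

/-- A general measure-preserving `X` serves both sides of the convergence: the identity of `Ω` for
the oscillating sequence, and the projection `Ω × 𝕋 → Ω` for the limit. -/
theorem memLp_comp_mul {X : α → β} (hX : MeasurePreserving X ν μ) {g : α → ℂ}
    (hg : AEStronglyMeasurable g ν) (hg1 : ∀ p, ‖g p‖ = 1) {f : β → ℂ} (hf : MemLp f 2 μ) :
    MemLp (fun p => f (X p) * g p) 2 ν :=
  (hf.comp_measurePreserving hX).of_le
    ((hf.comp_measurePreserving hX).aestronglyMeasurable.mul hg)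
    (Eventually.of_forall fun p => by simp [hg1])

/-- The isometry `f ↦ (f ∘ X) g` between `L²` spaces, where `X` preserves the measure and `g` is
unimodular. -/
noncomputable def twist {X : α → β} (hX : MeasurePreserving X ν μ) {g : α → ℂ}
    (hg : AEStronglyMeasurable g ν) (hg1 : ∀ p, ‖g p‖ = 1) : Lp ℂ 2 μ →ₗᵢ[ℂ] Lp ℂ 2 ν where
  toFun f := (memLp_comp_mul hX hg hg1 (Lp.memLp f)).toLp _
  map_add' f f' := by
    rw [← MemLp.toLp_add]
    refine MemLp.toLp_congr _ _ ?_
    filter_upwards [hX.quasiMeasurePreserving.ae_eq (Lp.coeFn_add f f')] with p hp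
    simp only [Function.comp_apply, Pi.add_apply] at hp ⊢
    rw [hp, add_mul]
  map_smul' r f := by
    rw [RingHom.id_apply, ← MemLp.toLp_const_smul]
    refine MemLp.toLp_congr _ _ ?_
    filter_upwards [hX.quasiMeasurePreserving.ae_eq (Lp.coeFn_smul r f)] with p hp
    simp only [Function.comp_apply, Pi.smul_apply, smul_eq_mul] at hp ⊢
    rw [hp, mul_assoc]
  norm_map' f := by
    change ‖(memLp_comp_mul hX hg hg1 (Lp.memLp f)).toLp _‖ = _
    rw [Lp.norm_toLp, Lp.norm_def, ← eLpNorm_comp_measurePreserving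
      (Lp.aestronglyMeasurable f) hX]
    congr 1
    exact eLpNorm_congr_norm_ae (Eventually.of_forall fun p => by simp [hg1])

theorem coeFn_twist {X : α → β} (hX : MeasurePreserving X ν μ) {g : α → ℂ}
    (hg : AEStronglyMeasurable g ν) (hg1 : ∀ p, ‖g p‖ = 1) (f : Lp ℂ 2 μ) :
    twist hX hg hg1 f =ᵐ[ν] fun p => f (X p) * g p :=
  MemLp.coeFn_toLp (memLp_comp_mul hX hg hg1 (Lp.memLp f))

theorem inner_twist {X : α → β} (hX : MeasurePreserving X ν μ) {g : α → ℂ}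
    (hg : AEStronglyMeasurable g ν) (hg1 : ∀ p, ‖g p‖ = 1) (f : Lp ℂ 2 μ) (h : Lp ℂ 2 ν) :
    ⟪twist hX hg hg1 f, h⟫_ℂ = ∫ p, h p * conj (f (X p) * g p) ∂ν := by
  rw [L2.inner_def]
  refine integral_congr_ae ?_
  filter_upwards [coeFn_twist hX hg hg1 f] with p hp
  rw [hp, RCLike.inner_apply]

theorem inner_twist_twist {X : α → β} (hX : MeasurePreserving X ν μ) {g g' : α → ℂ}
    (hg : AEStronglyMeasurable g ν) (hg1 : ∀ p, ‖g p‖ = 1)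
    (hg' : AEStronglyMeasurable g' ν) (hg1' : ∀ p, ‖g' p‖ = 1) (f f' : Lp ℂ 2 μ) :
    ⟪twist hX hg hg1 f, twist hX hg' hg1' f'⟫_ℂ =
      ∫ p, (f' (X p) * conj (f (X p))) * (g' p * conj (g p)) ∂ν := by
  rw [inner_twist]
  refine integral_congr_ae ?_
  filter_upwards [coeFn_twist hX hg' hg1' f'] with p hp
  rw [hp, map_mul]
  ring

end Twist

theorem enorm_integral_mul_le {α : Type*} [MeasurableSpace α] {ν : Measure α} {f g : α → ℂ}
    (hf : AEStronglyMeasurable f ν) (hg : AEStronglyMeasurable g ν) :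
    ‖∫ p, f p * g p ∂ν‖ₑ ≤ eLpNorm f 2 ν * eLpNorm g 2 ν := by
  refine (enorm_integral_le_lintegral_enorm _).trans ?_
  rw [← eLpNorm_one_eq_lintegral_enorm]
  have h : eLpNorm (f • g) 1 ν ≤ eLpNorm f 2 ν * eLpNorm g 2 ν :=
    eLpNorm_smul_le_mul_eLpNorm hg hf
  exact h

/-! ### Testing against continuous-function-valued families -/

section Functional

variable {α β T : Type*} [MeasurableSpace α] [MeasurableSpace β] {ν : Measure α} {μ : Measure β}
  [TopologicalSpace T] [CompactSpace T] [MeasurableSpace T]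

theorem aestronglyMeasurable_eval [PseudoMetrizableSpace T] [SecondCountableTopology T]
    [OpensMeasurableSpace T] {X : α → β} (hX : MeasurePreserving X ν μ) {Y : α → T}
    (hY : Measurable Y) {ψ : β → C(T, ℂ)} (hψ : AEStronglyMeasurable ψ μ) :
    AEStronglyMeasurable (fun p => ψ (X p) (Y p)) ν :=
  (ContinuousEval.continuous_eval (F := C(T, ℂ))).comp_aestronglyMeasurable
    ((hψ.comp_measurePreserving hX).prodMk hY.stronglyMeasurable.aestronglyMeasurable)

theorem memLp_eval [PseudoMetrizableSpace T] [SecondCountableTopology T]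
    [OpensMeasurableSpace T] {X : α → β} (hX : MeasurePreserving X ν μ) {Y : α → T}
    (hY : Measurable Y) {ψ : β → C(T, ℂ)} (hψ : MemLp ψ 2 μ) :
    MemLp (fun p => ψ (X p) (Y p)) 2 ν :=
  (hψ.comp_measurePreserving hX).of_le (aestronglyMeasurable_eval hX hY hψ.1)
    (Eventually.of_forall fun p => (ψ (X p)).norm_coe_le_norm _)

/-- Testing an `L²` function against Bochner `L²` families of continuous functions is a bounded
functional. -/
theorem exists_functional [PseudoMetrizableSpace T] [SecondCountableTopology T]
    [OpensMeasurableSpace T] {X : α → β} (hX : MeasurePreserving X ν μ) {Y : α → T}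
    (hY : Measurable Y) {v : α → ℂ} (hv : MemLp v 2 ν) :
    ∃ L : Lp C(T, ℂ) 2 μ →L[ℂ] ℂ, ‖L‖ ≤ (eLpNorm v 2 ν).toReal ∧
      ∀ (ψ : β → C(T, ℂ)) (hψ : MemLp ψ 2 μ),
        L (hψ.toLp ψ) = ∫ p, v p * ψ (X p) (Y p) ∂ν := by
  have hint : ∀ ψ : β → C(T, ℂ), MemLp ψ 2 μ →
      Integrable (fun p => v p * ψ (X p) (Y p)) ν := fun ψ hψ =>
    hv.integrable_mul (memLp_eval hX hY hψ)
  let L₀ : Lp C(T, ℂ) 2 μ →ₗ[ℂ] ℂ :=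
    { toFun := fun ψ => ∫ p, v p * ψ (X p) (Y p) ∂ν
      map_add' := fun ψ ψ' => by
        rw [← integral_add (hint _ (Lp.memLp ψ)) (hint _ (Lp.memLp ψ'))]
        refine integral_congr_ae ?_
        filter_upwards [hX.quasiMeasurePreserving.ae_eq (Lp.coeFn_add ψ ψ')] with p hp
        simp only [Function.comp_apply, Pi.add_apply] at hp
        rw [hp, ContinuousMap.add_apply, mul_add]
      map_smul' := fun r ψ => by
        rw [RingHom.id_apply, ← integral_smul]
        refine integral_congr_ae ?_
        filter_upwards [hX.quasiMeasurePreserving.ae_eq (Lp.coeFn_smul r ψ)] with p hp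
        simp only [Function.comp_apply, Pi.smul_apply] at hp
        rw [hp, ContinuousMap.smul_apply, smul_eq_mul, smul_eq_mul]
        ring }
  have hL₀ : ∀ ψ, ‖L₀ ψ‖ ≤ (eLpNorm v 2 ν).toReal * ‖ψ‖ := by
    intro ψ
    have hψ := Lp.memLp ψ
    have h1 : ‖L₀ ψ‖ₑ ≤ eLpNorm v 2 ν * eLpNorm ψ 2 μ := by
      calc ‖L₀ ψ‖ₑ ≤ eLpNorm v 2 ν * eLpNorm (fun p => ψ (X p) (Y p)) 2 ν :=
            enorm_integral_mul_le hv.1 (memLp_eval hX hY hψ).1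
        _ ≤ eLpNorm v 2 ν * eLpNorm (ψ ∘ X) 2 ν := by
          gcongr
          exact eLpNorm_mono fun p => (ψ (X p)).norm_coe_le_norm _
        _ = _ := by rw [eLpNorm_comp_measurePreserving hψ.1 hX]
    have h2 := ENNReal.toReal_mono (ENNReal.mul_ne_top hv.2.ne hψ.2.ne) h1
    rwa [toReal_enorm, ENNReal.toReal_mul, ← Lp.norm_def] at h2
  refine ⟨L₀.mkContinuous _ hL₀, L₀.mkContinuous_norm_le ENNReal.toReal_nonneg _,
    fun ψ hψ => integral_congr_ae ?_⟩
  filter_upwards [hX.quasiMeasurePreserving.ae_eq hψ.coeFn_toLp] with p hp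
  simp only [Function.comp_apply] at hp
  rw [hp]

/-- Pointwise convergence of a bounded sequence of functionals on `L²(β; E)` can be checked on
indicator functions with values in a set with dense span. -/
theorem tendsto_of_tendsto_indicator {E : Type*} [NormedAddCommGroup E] [NormedSpace ℂ E]
    {S : Set E} (hS : (Submodule.span ℂ S).topologicalClosure = ⊤)
    (L : ℕ → Lp E 2 μ →L[ℂ] ℂ) (L' : Lp E 2 μ →L[ℂ] ℂ) {C : ℝ} (hL : ∀ j, ‖L j‖ ≤ C)
    (h : ∀ e ∈ S, ∀ (s : Set β) (hs : MeasurableSet s) (hμs : μ s ≠ ∞),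
      Tendsto (fun j => L j (indicatorConstLp 2 hs hμs e)) atTop
        (𝓝 (L' (indicatorConstLp 2 hs hμs e)))) (ψ : Lp E 2 μ) :
    Tendsto (fun j => L j ψ) atTop (𝓝 (L' ψ)) := by
  -- The `ψ` for which convergence holds form a subspace, closed thanks to the uniform bound on the
  -- functionals. It then suffices to reach all indicator functions.
  let V : Submodule ℂ (Lp E 2 μ) :=
    { carrier := {ψ | Tendsto (fun j => L j ψ) atTop (𝓝 (L' ψ))}
      add_mem' := fun {a b} ha hb => by
        simpa only [Set.mem_ofPred_eq, map_add] using Tendsto.add ha hb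
      zero_mem' := by simp
      smul_mem' := fun r a ha => by
        simpa only [Set.mem_ofPred_eq, map_smul] using Tendsto.const_smul ha r }
  have hC : 0 ≤ C := (norm_nonneg _).trans (hL 0)
  have hV : IsClosed (V : Set (Lp E 2 μ)) := by
    refine isClosed_of_closure_subset fun ψ hψ => ?_
    refine Metric.tendsto_atTop.mpr fun δ hδ => ?_
    have hK : 0 < C + ‖L'‖ + 1 := by positivity
    obtain ⟨χ, hχ, hd⟩ := Metric.mem_closure_iff.mp hψ (δ / 2 / (C + ‖L'‖ + 1)) (by positivity)
    obtain ⟨N, hN⟩ := Metric.tendsto_atTop.mp hχ (δ / 2) (by positivity)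
    refine ⟨N, fun j hj => ?_⟩
    have h1 := hN j hj
    rw [dist_eq_norm] at h1 hd ⊢
    have h2 : L j ψ - L' ψ = (L j χ - L' χ) + (L j (ψ - χ) - L' (ψ - χ)) := by
      simp only [map_sub]; ring
    have h3 : ‖L j (ψ - χ)‖ ≤ C * ‖ψ - χ‖ := (L j).le_of_opNorm_le (hL j) _
    have h4 : ‖L' (ψ - χ)‖ ≤ ‖L'‖ * ‖ψ - χ‖ := L'.le_opNorm _
    have h5 : (C + ‖L'‖ + 1) * ‖ψ - χ‖ < δ / 2 := by
      rwa [lt_div_iff₀ hK, mul_comm] at hd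
    have h6 := norm_nonneg (ψ - χ)
    calc ‖L j ψ - L' ψ‖ ≤ ‖L j χ - L' χ‖ + (‖L j (ψ - χ)‖ + ‖L' (ψ - χ)‖) := by
          rw [h2]; exact (norm_add_le _ _).trans (by gcongr; exact norm_sub_le _ _)
      _ < δ := by nlinarith
  have hind : ∀ (e : E) (s : Set β) (hs : MeasurableSet s) (hμs : μ s ≠ ∞),
      indicatorConstLp 2 hs hμs e ∈ V := by
    intro e s hs hμs
    let A : E →L[ℂ] Lp E 2 μ := LinearMap.mkContinuous
      { toFun := fun e => indicatorConstLp 2 hs hμs e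
        map_add' := fun a b => indicatorConstLp_add.symm
        map_smul' := fun r a => by
          rw [RingHom.id_apply, indicatorConstLp, indicatorConstLp, ← MemLp.toLp_const_smul]
          exact MemLp.toLp_congr _ _ (Eventually.of_forall fun x =>
            congrFun (Set.indicator_const_smul s r fun _ => a) x) }
      (μ.real s ^ (1 / (2 : ℝ≥0∞).toReal)) (fun e => by
        rw [mul_comm]
        exact norm_indicatorConstLp_le (hs := hs) (hμs := hμs) (c := e))
    -- For a fixed set `s`, the values `e` whose indicator lies in `V` form a closed subspace
    -- containing `S`, hence all of `E`.
    have h1 : Submodule.span ℂ S ≤ V.comap A.toLinearMap :=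
      Submodule.span_le.mpr fun e he => h e he s hs hμs
    have h2 : (Submodule.span ℂ S).topologicalClosure ≤ V.comap A.toLinearMap :=
      Submodule.topologicalClosure_minimal _ h1 (hV.preimage A.continuous)
    rw [hS] at h2
    exact h2 (Submodule.mem_top (x := e))
  refine Lp.induction (p := 2) ENNReal.ofNat_ne_top (motive := fun ψ => ψ ∈ V) ?_ ?_ hV ψ
  · intro c s hs hμs
    exact hind c s hs hμs.ne
  · intro f g hf hg _ h1 h2
    exact V.add_mem h1 h2

end Functional

end CutProject

namespace CutProject

open scoped InnerProductSpace ComplexConjugate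

/-! ### Modulation by Fourier monomials -/

section Modulation

theorem norm_mFourier_apply {σ : Type*} [Fintype σ] (k : σ → ℤ) (y : UnitAddTorus σ) :
    ‖UnitAddTorus.mFourier k y‖ = 1 := by
  simp only [UnitAddTorus.mFourier, fourier_apply, ContinuousMap.coe_mk, norm_prod,
    Circle.norm_coe, Finset.prod_const_one]

variable {α β σ : Type*} [MeasurableSpace α] [MeasurableSpace β] [Fintype σ]
  {ν : Measure α} {μ : Measure β}

/-- The isometry `f ↦ (f ∘ X) e_k(Y)`, where `e_k` is the Fourier monomial of frequency `k`. -/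
noncomputable def modulation {X : α → β} (hX : MeasurePreserving X ν μ)
    {Y : α → UnitAddTorus σ} (hY : Measurable Y) (k : σ → ℤ) : Lp ℂ 2 μ →ₗᵢ[ℂ] Lp ℂ 2 ν :=
  twist hX (g := fun p => UnitAddTorus.mFourier k (Y p))
    ((UnitAddTorus.mFourier k).continuous.measurable.comp hY).aestronglyMeasurable
    fun p => norm_mFourier_apply k (Y p)

variable {X : α → β} (hX : MeasurePreserving X ν μ) {Y : α → UnitAddTorus σ} (hY : Measurable Y)

theorem coeFn_modulation (k : σ → ℤ) (f : Lp ℂ 2 μ) :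
    modulation hX hY k f =ᵐ[ν] fun p => f (X p) * UnitAddTorus.mFourier k (Y p) :=
  coeFn_twist hX _ _ f

theorem inner_modulation (k : σ → ℤ) (f : Lp ℂ 2 μ) (h : Lp ℂ 2 ν) :
    ⟪modulation hX hY k f, h⟫_ℂ =
      ∫ p, h p * conj (f (X p) * UnitAddTorus.mFourier k (Y p)) ∂ν :=
  inner_twist hX _ _ f h

theorem inner_modulation_modulation (k l : σ → ℤ) (f f' : Lp ℂ 2 μ) :
    ⟪modulation hX hY k f, modulation hX hY l f'⟫_ℂ =
      ∫ p, (f' (X p) * conj (f (X p))) * UnitAddTorus.mFourier (l - k) (Y p) ∂ν := by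
  rw [modulation, modulation, inner_twist_twist]
  simp only [sub_eq_add_neg, UnitAddTorus.mFourier_add, UnitAddTorus.mFourier_neg]

/-- Links test functions to Fourier coefficients. The frequency is `-k` because the inner product
conjugates its first argument. -/
theorem integral_mul_indicator_mFourier {v : α → ℂ} (hv : MemLp v 2 ν) (k : σ → ℤ)
    {s : Set β} (hs : MeasurableSet s) (hμs : μ s ≠ ∞) :
    ∫ p, v p * s.indicator (fun _ => UnitAddTorus.mFourier k) (X p) (Y p) ∂ν =
      ⟪modulation hX hY (-k) (indicatorConstLp 2 hs hμs 1), hv.toLp v⟫_ℂ := by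
  rw [inner_modulation]
  refine integral_congr_ae ?_
  filter_upwards [hv.coeFn_toLp, hX.quasiMeasurePreserving.ae_eq
    (indicatorConstLp_coeFn (p := 2) (hs := hs) (hμs := hμs) (c := (1 : ℂ)))] with p hp hp'
  simp only [Function.comp_apply] at hp'
  rw [hp, hp', UnitAddTorus.mFourier_neg]
  by_cases h : X p ∈ s <;> simp [h]

end Modulation

/-! ### Orthogonality of the monomials on the product torus -/

section Torus

variable {d n : ℕ} {m : Fin n → ℕ}

instance isProbabilityMeasure_torusMeasure : IsProbabilityMeasure (torusMeasure m) := by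
  unfold torusMeasure
  infer_instance

/-- Translation by half a period changes the sign of the integrand and preserves Haar measure. -/
theorem integral_fourier_eq_zero {k : ℤ} (hk : k ≠ 0) :
    ∫ t, fourier k t ∂(AddCircle.haarAddCircle : Measure UnitAddCircle) = 0 :=
  integral_eq_zero_of_add_right_eq_neg (μ := AddCircle.haarAddCircle)
    (fourier_add_half_inv_index hk (zero_lt_one (α := ℝ)))

theorem integral_mFourier_eq_zero {k : Freq m} (hk : k ≠ 0) :
    ∫ y, UnitAddTorus.mFourier k y ∂(torusMeasure m) = 0 := by
  obtain ⟨s, hs⟩ := Function.ne_iff.mp hk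
  simp only [UnitAddTorus.mFourier, ContinuousMap.coe_mk, torusMeasure]
  rw [integral_fintype_prod_eq_prod (fun s (t : UnitAddCircle) => fourier (k s) t)]
  exact Finset.prod_eq_zero (Finset.mem_univ s) (integral_fourier_eq_zero hs)

theorem measurePreserving_fst_prodMeasure (Ω : Opens (Space d)) :
    MeasurePreserving Prod.fst (prodMeasure Ω m) (volume.restrict (Ω : Set (Space d))) :=
  measurePreserving_fst

/-- The isometry `f ↦ f ⊗ e_k` from `L²(Ω)` to `L²(Ω × 𝕋)`. -/
noncomputable def tensor (Ω : Opens (Space d)) (k : Freq m) :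
    Lp ℂ 2 (volume.restrict (Ω : Set (Space d))) →ₗᵢ[ℂ] Lp ℂ 2 (prodMeasure Ω m) :=
  modulation (measurePreserving_fst_prodMeasure Ω) measurable_snd k

theorem orthogonalFamily_tensor (Ω : Opens (Space d)) :
    OrthogonalFamily ℂ (fun _ : Freq m => Lp ℂ 2 (volume.restrict (Ω : Set (Space d))))
      (fun k => tensor Ω k) := by
  intro k l hkl f f'
  simp only [tensor]
  rw [inner_modulation_modulation, prodMeasure,
    integral_prod_mul (fun x => f' x * conj (f x)) (UnitAddTorus.mFourier (l - k)),
    integral_mFourier_eq_zero (sub_ne_zero.mpr hkl.symm), mul_zero]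

end Torus

/-! ### Plane waves, separated scales and asymptotic orthogonality -/

section Waves

variable {d n : ℕ} {m : Fin n → ℕ} (M : ∀ i, Matrix (Fin (m i)) (Fin d) ℝ)

theorem continuous_cutProj (e : Fin n → ℝ) : Continuous (cutProj M e) := by
  refine continuous_pi fun s => (AddCircle.continuous_mk' 1).comp ?_
  simp only [Matrix.mulVec, dotProduct]
  fun_prop

/-- The wave vector `∑ᵢ Mᵢᵀ kᵢ / eᵢ` of the oscillation `x ↦ e_k(M₁ x / e₁, …, Mₙ x / eₙ)`. -/
noncomputable def waveVector (e : Fin n → ℝ) (k : Freq m) : Space d :=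
  WithLp.toLp 2 fun a => ∑ s, k s * M s.1 s.2 a / e s.1

theorem mFourier_cutProj (e : Fin n → ℝ) (k : Freq m) (x : Space d) :
    UnitAddTorus.mFourier k (cutProj M e x) =
      Complex.exp ((2 * Real.pi * ⟪x, waveVector M e k⟫_ℝ : ℝ) * Complex.I) := by
  simp only [UnitAddTorus.mFourier, ContinuousMap.coe_mk, cutProj, fourier_coe_apply]
  rw [← Complex.exp_sum]
  congr 1
  have h : ⟪x, waveVector M e k⟫_ℝ = ∑ s, k s * ((M s.1 *ᵥ x.ofLp) s.2 / e s.1) := by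
    simp only [waveVector, PiLp.inner_apply, RCLike.inner_apply, conj_trivial, Matrix.mulVec,
      dotProduct, Finset.sum_mul]
    rw [Finset.sum_comm]
    refine Finset.sum_congr rfl fun s _ => ?_
    rw [Finset.sum_div, Finset.mul_sum]
    exact Finset.sum_congr rfl fun a _ => by ring
  rw [h]
  push_cast
  rw [Finset.mul_sum, Finset.sum_mul]
  exact Finset.sum_congr rfl fun s _ => by ring

variable {M}

/-- `k` vanishes beyond the level `ℓ`, but not at the level `ℓ`. -/
abbrev IsLevel (k : Freq m) (ℓ : Fin n) : Prop :=
  (∃ j, k ⟨ℓ, j⟩ ≠ 0) ∧ ∀ i, ℓ < i → ∀ j, k ⟨i, j⟩ = 0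

theorem exists_isLevel {k : Freq m} (hk : k ≠ 0) : ∃ ℓ, IsLevel k ℓ := by
  classical
  obtain ⟨⟨i, j⟩, hij⟩ := Function.ne_iff.mp hk
  let S : Finset (Fin n) := Finset.univ.filter fun i => ∃ j, k ⟨i, j⟩ ≠ 0
  have hS : S.Nonempty := ⟨i, by simpa [S] using ⟨j, hij⟩⟩
  refine ⟨S.max' hS, by simpa [S] using S.max'_mem hS, fun i hi j => ?_⟩
  by_contra h
  exact (S.le_max' i (by simpa [S] using ⟨j, h⟩)).not_gt hi

theorem IsLevel.unique {k : Freq m} {ℓ ℓ' : Fin n} (h : IsLevel k ℓ) (h' : IsLevel k ℓ') :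
    ℓ = ℓ' := by
  rcases lt_trichotomy ℓ ℓ' with hlt | rfl | hlt
  · exact absurd (h.2 ℓ' hlt h'.1.choose) h'.1.choose_spec
  · rfl
  · exact absurd (h'.2 ℓ hlt h.1.choose) h.1.choose_spec

theorem IsLevel.ne_zero {k : Freq m} {ℓ : Fin n} (h : IsLevel k ℓ) : k ≠ 0 := by
  rintro rfl
  exact h.1.choose_spec rfl

theorem ScaleSeparated.comp [NeZero n] {ε : ℕ → Fin n → ℝ} (hε : ScaleSeparated ε) {φ : ℕ → ℕ}
    (hφ : StrictMono φ) : ScaleSeparated (ε ∘ φ) where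
  pos k i := hε.pos (φ k) i
  first := hε.first.comp hφ.tendsto_atTop
  ratio i j h := (hε.ratio i j h).comp hφ.tendsto_atTop

theorem ScaleSeparated.tendsto_div [NeZero n] {ε : ℕ → Fin n → ℝ} (hε : ScaleSeparated ε)
    {i ℓ : Fin n} (h : i < ℓ) : Tendsto (fun k => ε k ℓ / ε k i) atTop (𝓝 0) := by
  obtain ⟨l, hl⟩ := ℓ
  induction l with
  | zero => exact absurd (Fin.lt_def.mp h) (Nat.not_lt_zero _)
  | succ l ih =>
    have hl' : l < n := Nat.lt_of_succ_lt hl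
    have h1 := hε.ratio ⟨l, hl'⟩ ⟨l + 1, hl⟩ rfl
    rcases (Nat.lt_succ_iff.mp h).eq_or_lt with heq | hlt
    · have : i = ⟨l, hl'⟩ := Fin.ext heq
      rwa [this]
    · have h2 := h1.mul (ih hl' hlt)
      rw [mul_zero] at h2
      refine h2.congr fun k => ?_
      have := (hε.pos k ⟨l, hl'⟩).ne'
      field_simp

theorem ScaleSeparated.tendsto_zero [NeZero n] {ε : ℕ → Fin n → ℝ} (hε : ScaleSeparated ε)
    (ℓ : Fin n) : Tendsto (fun k => ε k ℓ) atTop (𝓝 0) := by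
  rcases (show (0 : Fin n) ≤ ℓ from Fin.le_def.mpr (by simp)).eq_or_lt with h | h
  · rw [← h]
    exact hε.first
  · have h2 := (hε.tendsto_div h).mul hε.first
    rw [mul_zero] at h2
    exact h2.congr fun k => div_mul_cancel₀ _ (hε.pos k 0).ne'

/-- Multiplication by `ε_ℓ` gives the level `i` the factor `ε_ℓ/ε_i`. This tends to `0` for `i < ℓ`
and equals `1` for `i = ℓ`; for `i > ℓ` the entries of `k` vanish. -/
theorem tendsto_mul_waveVector [NeZero n] {ε : ℕ → Fin n → ℝ} (hε : ScaleSeparated ε)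
    {k : Freq m} {ℓ : Fin n} (hk : IsLevel k ℓ) (a : Fin d) :
    Tendsto (fun j => ε j ℓ * waveVector M (ε j) k a) atTop
      (𝓝 (((M ℓ)ᵀ *ᵥ fun j => (k ⟨ℓ, j⟩ : ℝ)) a)) := by
  have h1 : ∀ j, ε j ℓ * waveVector M (ε j) k a =
      ∑ i, ∑ b, k ⟨i, b⟩ * M i b a * (ε j ℓ / ε j i) := by
    intro j
    simp only [waveVector]
    rw [Fintype.sum_sigma, Finset.mul_sum]
    refine Finset.sum_congr rfl fun i _ => ?_
    rw [Finset.mul_sum]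
    exact Finset.sum_congr rfl fun b _ => by ring
  have h2 : ((M ℓ)ᵀ *ᵥ fun j => (k ⟨ℓ, j⟩ : ℝ)) a =
      ∑ i, ∑ b, k ⟨i, b⟩ * M i b a * (if i = ℓ then 1 else 0) := by
    rw [Finset.sum_eq_single ℓ (fun i _ hi => by simp [hi]) (by simp)]
    simp [Matrix.mulVec, dotProduct, mul_comm]
  rw [h2]
  simp only [h1]
  refine tendsto_finsetSum _ fun i _ => tendsto_finsetSum _ fun b _ => ?_
  rcases lt_trichotomy i ℓ with h | rfl | h
  · rw [if_neg h.ne]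
    exact (hε.tendsto_div h).const_mul _
  · refine Tendsto.const_mul _ ?_
    rw [if_pos rfl]
    exact tendsto_const_nhds.congr fun j => (div_self (hε.pos j i).ne').symm
  · simp [hk.2 i h b]

/-- By non-degeneracy some component of `M_ℓᵀk_ℓ` is nonzero. The same component of the wave vector
therefore grows like `1/ε_ℓ`. -/
theorem tendsto_waveVector_cocompact [NeZero n] {ε : ℕ → Fin n → ℝ} (hε : ScaleSeparated ε)
    (hM : ∀ i, NonDegenerate (M i)) {k : Freq m} (hk : k ≠ 0) :
    Tendsto (fun j => waveVector M (ε j) k) atTop (cocompact (Space d)) := by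
  obtain ⟨ℓ, hℓ⟩ := exists_isLevel hk
  obtain ⟨a, ha⟩ := Function.ne_iff.mp (hM ℓ (fun j => k ⟨ℓ, j⟩)
    (Function.ne_iff.mpr hℓ.1))
  rw [← Metric.cobounded_eq_cocompact, ← tendsto_norm_atTop_iff_cobounded]
  have h1 := (tendsto_mul_waveVector (M := M) hε hℓ a).abs
  have h2 : Tendsto (fun j => (ε j ℓ)⁻¹) atTop atTop :=
    Tendsto.inv_tendsto_nhdsGT_zero (tendsto_nhdsWithin_iff.mpr
      ⟨hε.tendsto_zero ℓ, Eventually.of_forall fun j => hε.pos j ℓ⟩)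
  refine tendsto_atTop_mono (fun j => ?_) (h1.pos_mul_atTop (abs_pos.mpr ha) h2)
  have hp := hε.pos j ℓ
  rw [abs_mul, abs_of_pos hp, mul_comm (ε j ℓ), mul_assoc, mul_inv_cancel₀ hp.ne', mul_one]
  exact PiLp.norm_apply_le (waveVector M (ε j) k) a

theorem tendsto_integral_mul_mFourier_cutProj [NeZero n] {ε : ℕ → Fin n → ℝ}
    (hε : ScaleSeparated ε) (hM : ∀ i, NonDegenerate (M i)) {k : Freq m} (hk : k ≠ 0)
    (Ω : Opens (Space d)) (f : Space d → ℂ) :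
    Tendsto (fun j => ∫ x in (Ω : Set (Space d)),
      f x * UnitAddTorus.mFourier k (cutProj M (ε j) x)) atTop (𝓝 0) := by
  -- Riemann-Lebesgue is stated with the kernel `exp(-2πi⟪x, ξ⟫)`, hence the frequency `-k`. It
  -- needs no integrability of `f`, since the integrals are `0` otherwise.
  have h1 := (tendsto_integral_exp_inner_smul_cocompact
    ((Ω : Set (Space d)).indicator f)).comp
      (tendsto_waveVector_cocompact (M := M) hε hM (neg_ne_zero.mpr hk))
  refine h1.congr fun j => ?_
  rw [← integral_indicator Ω.isOpen.measurableSet]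
  refine integral_congr_ae (Eventually.of_forall fun x => ?_)
  have hneg : waveVector M (ε j) (-k) = - waveVector M (ε j) k := by
    ext a
    simp [waveVector, neg_div]
  by_cases hx : x ∈ (Ω : Set (Space d))
  · simp only [Set.indicator_of_mem hx, hneg, inner_neg_right, neg_neg]
    rw [mFourier_cutProj, Circle.smul_def, Real.fourierChar_apply, smul_eq_mul, mul_comm]
  · simp [hx]

variable (M) in
/-- Multiplication by `x ↦ e_k(M₁ x / e₁, …, Mₙ x / eₙ)` on `L²(Ω)`. -/
noncomputable def oscillation (Ω : Opens (Space d)) (e : Fin n → ℝ) (k : Freq m) :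
    Lp ℂ 2 (volume.restrict (Ω : Set (Space d))) →ₗᵢ[ℂ]
      Lp ℂ 2 (volume.restrict (Ω : Set (Space d))) :=
  modulation (MeasurePreserving.id _) (continuous_cutProj M e).measurable k

theorem tendsto_inner_oscillation [NeZero n] {ε : ℕ → Fin n → ℝ}
    (hε : ScaleSeparated ε) (hM : ∀ i, NonDegenerate (M i)) (Ω : Opens (Space d))
    (k l : Freq m) (hkl : k ≠ l) (f g : Lp ℂ 2 (volume.restrict (Ω : Set (Space d)))) :
    Tendsto (fun j => ⟪oscillation M Ω (ε j) k f, oscillation M Ω (ε j) l g⟫_ℂ) atTop (𝓝 0) := by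
  simp only [oscillation, inner_modulation_modulation]
  exact tendsto_integral_mul_mFourier_cutProj hε hM (sub_ne_zero.mpr hkl.symm) Ω _

/-- Multiscale convergence follows from the convergence of the Fourier coefficients. -/
theorem multiscaleConverges_of_tendsto_inner {Ω : Opens (Space d)} {ε : ℕ → Fin n → ℝ}
    {v : ℕ → Space d → ℂ} (hv : ∀ j, MemLp (v j) 2 (volume.restrict (Ω : Set (Space d))))
    {C : ℝ} (hC : ∀ j, ‖(hv j).toLp (v j)‖ ≤ C)
    {w : Space d × Torus m → ℂ} (hw : MemLp w 2 (prodMeasure Ω m))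
    (h : ∀ k f, Tendsto (fun j => ⟪oscillation M Ω (ε j) k f, (hv j).toLp (v j)⟫_ℂ) atTop
      (𝓝 ⟪tensor Ω k f, hw.toLp w⟫_ℂ)) :
    MultiscaleConverges Ω M ε v w where
  memLp_seq := hv
  memLp_limit := hw
  tendsto ψ hψ := by
    choose L hL hL' using fun j => exists_functional
      (MeasurePreserving.id (volume.restrict (Ω : Set (Space d))))
      (continuous_cutProj M (ε j)).measurable (hv j)
    obtain ⟨L₀, -, hL₀⟩ := exists_functional (measurePreserving_fst_prodMeasure Ω)
      (measurable_snd (β := Torus m)) hw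
    have key := tendsto_of_tendsto_indicator
      (UnitAddTorus.span_mFourier_closure_eq_top (d := Σ i : Fin n, Fin (m i))) L L₀ (C := C)
      (fun j => (hL j).trans (by simpa [Lp.norm_toLp] using hC j)) (by
        rintro _ ⟨k, rfl⟩ s hs hμs
        simp only [indicatorConstLp, hL', hL₀]
        have := h (-k) (indicatorConstLp 2 hs hμs 1)
        simp only [oscillation, tensor, ← integral_mul_indicator_mFourier] at this
        exact this) (hψ.toLp ψ)
    simpa only [hL', hL₀, id] using key

end Waves

end CutProject

namespace CutProject

open scoped InnerProductSpace ComplexConjugate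

/-! ### Integration by parts against plane waves -/

section Sobolev

variable {d n : ℕ} {m : Fin n → ℕ} {Ω : Opens (Space d)}

/-- The complex Hilbert space `L²(Ω)`. -/
abbrev L2 (Ω : Opens (Space d)) : Type := Lp ℂ 2 (volume.restrict (Ω : Set (Space d)))

theorem continuous_grad_apply {𝕜 : Type*} [RCLike 𝕜] (φ : TestFunction Ω 𝕜 ⊤) (a : Fin d) :
    Continuous fun x => grad φ x a :=
  (φ.contDiff.continuous_fderiv (by simp)).clm_apply continuous_const

theorem memLp_testFunction {𝕜 : Type*} [RCLike 𝕜] (φ : TestFunction Ω 𝕜 ⊤) :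
    MemLp φ 2 (volume.restrict (Ω : Set (Space d))) :=
  (φ.continuous.memLp_of_hasCompactSupport φ.hasCompactSupport).restrict _

theorem memLp_grad_testFunction {𝕜 : Type*} [RCLike 𝕜] (φ : TestFunction Ω 𝕜 ⊤) (a : Fin d) :
    MemLp (fun x => grad φ x a) 2 (volume.restrict (Ω : Set (Space d))) :=
  ((continuous_grad_apply φ a).memLp_of_hasCompactSupport
    (φ.hasCompactSupport.fderiv_apply (𝕜 := ℝ) _)).restrict _

/-- The product of a test function and a complex exponential. -/
noncomputable def mulExp (φ : TestFunction Ω ℂ ⊤) (Λ : Space d →L[ℝ] ℂ) :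
    TestFunction Ω ℂ ⊤ where
  toFun x := φ x * Complex.exp (Λ x)
  contDiff' := φ.contDiff.mul (Complex.contDiff_exp.comp Λ.contDiff)
  hasCompactSupport' := φ.hasCompactSupport.mul_right
  tsupport_subset' := (tsupport_mul_subset_left).trans φ.tsupport_subset

theorem grad_mulExp (φ : TestFunction Ω ℂ ⊤) (Λ : Space d →L[ℝ] ℂ) (x : Space d) (a : Fin d) :
    grad (mulExp φ Λ) x a = grad φ x a * Complex.exp (Λ x) +
      Λ (EuclideanSpace.single a 1) * (φ x * Complex.exp (Λ x)) := by
  have h1 : HasFDerivAt φ (fderiv ℝ φ x) x :=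
    (φ.contDiff.differentiable (by simp) x).hasFDerivAt
  have h2 : HasFDerivAt (fun y => φ y * Complex.exp (Λ y)) _ x := h1.mul Λ.hasFDerivAt.cexp
  change fderiv ℝ (fun y => φ y * Complex.exp (Λ y)) x _ = fderiv ℝ φ x _ * _ + _
  rw [h2.fderiv]
  simp only [add_apply, smul_apply, smul_eq_mul]
  ring

theorem MemH1.integral_mul_exp {u : Space d → ℂ} {G : Space d → Vec ℂ d} (h : MemH1 Ω u G)
    (φ : TestFunction Ω ℂ ⊤) (Λ : Space d →L[ℝ] ℂ) (a : Fin d) :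
    (∫ x in (Ω : Set (Space d)), u x * (grad φ x a * Complex.exp (Λ x))) +
      Λ (EuclideanSpace.single a 1) *
        ∫ x in (Ω : Set (Space d)), u x * (φ x * Complex.exp (Λ x)) =
      - ∫ x in (Ω : Set (Space d)), G x a * (φ x * Complex.exp (Λ x)) := by
  have h0 := h.hasWeakGradient (mulExp φ Λ) a
  have hi : Integrable (fun x => u x * (φ x * Complex.exp (Λ x)))
      (volume.restrict (Ω : Set (Space d))) :=
    h.memLp.integrable_mul (memLp_testFunction (mulExp φ Λ))
  have hi' : Integrable (fun x => u x * (grad φ x a * Complex.exp (Λ x)))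
      (volume.restrict (Ω : Set (Space d))) := by
    refine h.memLp.integrable_mul (q := 2) ?_
    have h3 : MemLp (fun x => grad (mulExp φ Λ) x a - Λ (EuclideanSpace.single a 1) *
        mulExp φ Λ x) 2 (volume.restrict (Ω : Set (Space d))) :=
      (memLp_grad_testFunction (mulExp φ Λ) a).sub ((memLp_testFunction (mulExp φ Λ)).const_mul _)
    refine h3.ae_eq (Eventually.of_forall fun x => ?_)
    simp only [grad_mulExp]
    exact add_sub_cancel_right _ _
  rw [← integral_const_mul, ← integral_add hi' (hi.const_mul _)]
  refine Eq.trans (integral_congr_ae (Eventually.of_forall fun x => ?_)) h0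
  simp only [grad_mulExp]
  ring

/-- The conjugate of a test function, as an element of `L²(Ω)`. -/
noncomputable def conjTest (φ : TestFunction Ω ℂ ⊤) : L2 Ω :=
  ((memLp_testFunction φ).star).toLp _

/-- The conjugate of a partial derivative of a test function, as an element of `L²(Ω)`. -/
noncomputable def conjGradTest (φ : TestFunction Ω ℂ ⊤) (a : Fin d) : L2 Ω :=
  ((memLp_grad_testFunction φ a).star).toLp _

variable (M : ∀ i, Matrix (Fin (m i)) (Fin d) ℝ)

theorem inner_oscillation_toLp_star (e : Fin n → ℝ) (k : Freq m) {f v : Space d → ℂ}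
    (hf : MemLp f 2 (volume.restrict (Ω : Set (Space d))))
    (hv : MemLp v 2 (volume.restrict (Ω : Set (Space d)))) :
    ⟪oscillation M Ω e k (hf.star.toLp _), hv.toLp v⟫_ℂ = ∫ x in (Ω : Set (Space d)), v x *
      (f x * Complex.exp (((-(2 * Real.pi * Complex.I)) • Complex.ofRealCLM.comp
        (innerSL ℝ (waveVector M e k))) x)) := by
  rw [oscillation, inner_modulation]
  refine integral_congr_ae ?_
  filter_upwards [hv.coeFn_toLp, hf.star.coeFn_toLp] with x hx hx'
  simp only [id] at hx' ⊢
  rw [hx, hx', mFourier_cutProj, map_mul, ← Complex.exp_conj]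
  congr 2
  · simp
  · congr 1
    rw [real_inner_comm]
    simp only [map_mul, Complex.conj_ofReal, Complex.conj_I, smul_apply,
      ContinuousLinearMap.comp_apply, innerSL_apply_apply, Complex.ofRealCLM_apply, smul_eq_mul]
    push_cast
    ring

/-- The identity from which all information on the limits is drawn: the derivative of the plane wave
contributes the wave vector as a factor. -/
theorem MemH1.inner_oscillation {u : Space d → ℂ} {G : Space d → Vec ℂ d} (h : MemH1 Ω u G)
    (e : Fin n → ℝ) (k : Freq m) (φ : TestFunction Ω ℂ ⊤) (a : Fin d) :
    ⟪oscillation M Ω e k (conjGradTest φ a), h.memLp.toLp u⟫_ℂ -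
        2 * Real.pi * Complex.I * (waveVector M e k a : ℝ) *
          ⟪oscillation M Ω e k (conjTest φ), h.memLp.toLp u⟫_ℂ =
      -⟪oscillation M Ω e k (conjTest φ), (h.memLp_grad.eval_piLp a).toLp _⟫_ℂ := by
  have h0 := h.integral_mul_exp φ ((-(2 * Real.pi * Complex.I)) • Complex.ofRealCLM.comp
    (innerSL ℝ (waveVector M e k))) a
  rw [conjGradTest, conjTest, inner_oscillation_toLp_star M e k (memLp_grad_testFunction φ a),
    inner_oscillation_toLp_star M e k (memLp_testFunction φ),
    inner_oscillation_toLp_star M e k (memLp_testFunction φ), ← h0]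
  simp only [smul_apply, ContinuousLinearMap.comp_apply, innerSL_apply_apply,
    Complex.ofRealCLM_apply, smul_eq_mul, EuclideanSpace.inner_single_right]
  simp
  ring

/-- Conjugates of test functions are total in `L²(Ω)`. -/
theorem eq_zero_of_inner_conjTest [IsFiniteMeasure (volume.restrict (Ω : Set (Space d)))]
    (c : L2 Ω) (h : ∀ φ : TestFunction Ω ℂ ⊤, ⟪conjTest φ, c⟫_ℂ = 0) : c = 0 := by
  have hint : IntegrableOn c (Ω : Set (Space d)) volume := (Lp.memLp c).integrable (by norm_num)
  have key := Ω.isOpen.ae_eq_zero_of_integral_contDiff_smul_eq_zero (f := c) (μ := volume)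
    hint.locallyIntegrableOn (fun g hg hgc hgs => by
      let φ : TestFunction Ω ℂ ⊤ :=
        { toFun := fun x => (g x : ℂ)
          contDiff' := Complex.ofRealCLM.contDiff.comp hg
          hasCompactSupport' := hgc.comp_left (g := fun t : ℝ => (t : ℂ)) Complex.ofReal_zero
          tsupport_subset' := (closure_mono fun x hx => by
            simpa [Function.mem_support] using hx).trans hgs }
      have h1 := h φ
      rw [conjTest, L2.inner_def] at h1
      rw [← setIntegral_eq_integral_of_forall_compl_eq_zero
        (s := (Ω : Set (Space d))) (fun x hx => by
          rw [image_eq_zero_of_notMem_tsupport fun hx' => hx (hgs hx'), zero_smul]), ← h1]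
      refine integral_congr_ae ?_
      filter_upwards [(memLp_testFunction φ).star.coeFn_toLp] with x hx
      rw [hx]
      simp only [RCLike.inner_apply, Pi.star_apply, RCLike.star_def, Complex.conj_conj,
        Complex.real_smul]
      exact mul_comm _ _)
  rw [Lp.eq_zero_iff_ae_eq_zero]
  exact (ae_restrict_iff' Ω.isOpen.measurableSet).mpr key

variable {M}

/-- The oscillations of a bounded sequence in `H¹` vanish in the limit. -/
theorem limit_coefficient_eq_zero [NeZero n]
    [IsFiniteMeasure (volume.restrict (Ω : Set (Space d)))] {ε : ℕ → Fin n → ℝ}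
    (hε : ScaleSeparated ε) (hM : ∀ i, NonDegenerate (M i))
    {u : ℕ → Space d → ℂ} {G : ℕ → Space d → Vec ℂ d} (h : ∀ j, MemH1 Ω (u j) (G j))
    {k : Freq m} {c : L2 Ω} {b : Fin d → L2 Ω}
    (hc : ∀ f, Tendsto (fun j => ⟪oscillation M Ω (ε j) k f, (h j).memLp.toLp (u j)⟫_ℂ) atTop
      (𝓝 ⟪f, c⟫_ℂ))
    (hb : ∀ a f, Tendsto (fun j => ⟪oscillation M Ω (ε j) k f,
      ((h j).memLp_grad.eval_piLp a).toLp _⟫_ℂ) atTop (𝓝 ⟪f, b a⟫_ℂ))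
    (hk : k ≠ 0) : c = 0 := by
  obtain ⟨ℓ, hℓ⟩ := exists_isLevel hk
  obtain ⟨a, ha⟩ := Function.ne_iff.mp (hM ℓ (fun j => k ⟨ℓ, j⟩) (Function.ne_iff.mpr hℓ.1))
  refine eq_zero_of_inner_conjTest c fun φ => ?_
  have hε0 : Tendsto (fun j => ((ε j ℓ : ℝ) : ℂ)) atTop (𝓝 0) := by
    have := (Complex.continuous_ofReal.tendsto 0).comp (hε.tendsto_zero ℓ)
    rwa [Complex.ofReal_zero] at this
  have hζ := (Complex.continuous_ofReal.tendsto _).comp (tendsto_mul_waveVector (M := M) hε hℓ a)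
  -- In `ε_ℓ` times the integration by parts identity, only the term with `ε_ℓ ξₐ` survives, and its
  -- limit `(M_ℓᵀk_ℓ)ₐ` is nonzero.
  have h1 := (hε0.mul (hc (conjGradTest φ a))).sub
    ((hζ.const_mul (2 * Real.pi * Complex.I)).mul (hc (conjTest φ)))
  have h2 := (hε0.mul (hb a (conjTest φ))).neg
  have h3 := tendsto_nhds_unique h1 (h2.congr fun j => by
    have := (h j).inner_oscillation M (ε j) k φ a
    simp only [Function.comp_apply, Complex.ofReal_mul]
    rw [← mul_neg, ← this]
    ring)
  have h4 : (2 * Real.pi * Complex.I : ℂ) ≠ 0 := Complex.two_pi_I_ne_zero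
  have h5 : ((((M ℓ)ᵀ *ᵥ fun j => (k ⟨ℓ, j⟩ : ℝ)) a : ℝ) : ℂ) ≠ 0 :=
    Complex.ofReal_ne_zero.mpr ha
  rw [zero_mul, zero_mul, zero_sub, neg_zero, neg_eq_zero] at h3
  exact (mul_eq_zero.mp h3).resolve_left (mul_ne_zero h4 h5)

/-- The limits of the oscillations of the gradients are proportional to the wave direction. -/
theorem limit_grad_coefficient [NeZero n]
    [IsFiniteMeasure (volume.restrict (Ω : Set (Space d)))] {ε : ℕ → Fin n → ℝ}
    (hε : ScaleSeparated ε) (hM : ∀ i, NonDegenerate (M i))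
    {u : ℕ → Space d → ℂ} {G : ℕ → Space d → Vec ℂ d} (h : ∀ j, MemH1 Ω (u j) (G j))
    {k : Freq m} {c : L2 Ω} {b : Fin d → L2 Ω}
    (hc : ∀ f, Tendsto (fun j => ⟪oscillation M Ω (ε j) k f, (h j).memLp.toLp (u j)⟫_ℂ) atTop
      (𝓝 ⟪f, c⟫_ℂ))
    (hb : ∀ a f, Tendsto (fun j => ⟪oscillation M Ω (ε j) k f,
      ((h j).memLp_grad.eval_piLp a).toLp _⟫_ℂ) atTop (𝓝 ⟪f, b a⟫_ℂ))
    {ℓ : Fin n} (hℓ : IsLevel k ℓ) (a a' : Fin d) :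
    ((((M ℓ)ᵀ *ᵥ fun j => (k ⟨ℓ, j⟩ : ℝ)) a' : ℝ) : ℂ) • b a =
      ((((M ℓ)ᵀ *ᵥ fun j => (k ⟨ℓ, j⟩ : ℝ)) a : ℝ) : ℂ) • b a' := by
  have hc0 : c = 0 := limit_coefficient_eq_zero hε hM h hc hb hℓ.ne_zero
  subst hc0
  rw [← sub_eq_zero]
  refine eq_zero_of_inner_conjTest _ fun φ => ?_
  have hζ := fun a => (Complex.continuous_ofReal.tendsto _).comp
    (tendsto_mul_waveVector (M := M) hε hℓ a)
  -- Subtracting `ε_ℓ ξₐ'` times the identity for `a` and `ε_ℓ ξₐ` times that for `a'` cancels the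
  -- unbounded term in `ξₐ ξₐ'`. What remains of `u` tends to `0` because `c = 0`.
  have h1 := ((hζ a').mul (hb a (conjTest φ))).sub ((hζ a).mul (hb a' (conjTest φ)))
  have h2 := ((hζ a).mul (hc (conjGradTest φ a'))).sub ((hζ a').mul (hc (conjGradTest φ a)))
  have h3 := tendsto_nhds_unique h1 (h2.congr fun j => by
    have e1 := (h j).inner_oscillation M (ε j) k φ a
    have e2 := (h j).inner_oscillation M (ε j) k φ a'
    simp only [Function.comp_apply, Complex.ofReal_mul]
    linear_combination (ε j ℓ : ℂ) * (waveVector M (ε j) k a : ℂ) * e2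
      - (ε j ℓ : ℂ) * (waveVector M (ε j) k a' : ℂ) * e1)
  rw [inner_sub_right, inner_smul_right, inner_smul_right, h3]
  simp

/-- At frequency zero the wave vector vanishes, so the integration by parts identity passes to the
limit as it stands. -/
theorem hasWeakGradient_of_tendsto_inner
    {ε : ℕ → Fin n → ℝ} {u : ℕ → Space d → ℂ} {G : ℕ → Space d → Vec ℂ d}
    (h : ∀ j, MemH1 Ω (u j) (G j)) {c : L2 Ω} {b : Fin d → L2 Ω}
    (hc : ∀ f, Tendsto (fun j => ⟪oscillation M Ω (ε j) 0 f, (h j).memLp.toLp (u j)⟫_ℂ) atTop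
      (𝓝 ⟪f, c⟫_ℂ))
    (hb : ∀ a f, Tendsto (fun j => ⟪oscillation M Ω (ε j) 0 f,
      ((h j).memLp_grad.eval_piLp a).toLp _⟫_ℂ) atTop (𝓝 ⟪f, b a⟫_ℂ)) :
    HasWeakGradient Ω c (fun x => WithLp.toLp 2 fun a => b a x) := by
  intro φ a
  have h1 := tendsto_nhds_unique (hc (conjGradTest φ a)) ((hb a (conjTest φ)).neg.congr
    fun j => by
      rw [← (h j).inner_oscillation M (ε j) 0 φ a]
      simp [waveVector])
  rw [conjGradTest, conjTest, L2.inner_def, L2.inner_def] at h1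
  refine Eq.trans ?_ (h1.trans (congrArg Neg.neg ?_))
  · refine integral_congr_ae ?_
    filter_upwards [(memLp_grad_testFunction φ a).star.coeFn_toLp] with x hx
    rw [hx]
    simp [RCLike.inner_apply]
  · refine integral_congr_ae ?_
    filter_upwards [(memLp_testFunction φ).star.coeFn_toLp] with x hx
    rw [hx]
    simp [RCLike.inner_apply]

end Sobolev

end CutProject

namespace CutProject

open scoped InnerProductSpace ComplexConjugate

/-! ### Assembling the limit in the complex case -/

section Limit

variable {d n : ℕ} {m : Fin n → ℕ} {Ω : Opens (Space d)}

theorem norm_vec_le_sum {𝕜 : Type*} [RCLike 𝕜] (v : Vec 𝕜 d) : ‖v‖ ≤ ∑ a, ‖v a‖ := by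
  rw [EuclideanSpace.norm_eq]
  refine Real.sqrt_le_iff.mpr ⟨Finset.sum_nonneg fun a _ => norm_nonneg _, ?_⟩
  exact Finset.sum_sq_le_sq_sum_of_nonneg fun a _ => norm_nonneg _

theorem eLpNorm_vec_le_sum {𝕜 α : Type*} [RCLike 𝕜] [MeasurableSpace α] {ν : Measure α}
    {v : α → Vec 𝕜 d} (hv : ∀ a, AEStronglyMeasurable (fun x => v x a) ν) :
    eLpNorm v 2 ν ≤ ∑ a, eLpNorm (fun x => v x a) 2 ν := by
  calc eLpNorm v 2 ν ≤ eLpNorm (∑ a, fun x => ‖v x a‖) 2 ν :=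
        eLpNorm_mono_real fun x => by simpa using norm_vec_le_sum (v x)
    _ ≤ ∑ a, eLpNorm (fun x => ‖v x a‖) 2 ν :=
        eLpNorm_sum_le (fun a _ => (hv a).norm) (by norm_num)
    _ = _ := by simp only [eLpNorm_norm]

theorem coeFn_tensor (k : Freq m) (f : L2 Ω) :
    tensor Ω k f =ᵐ[prodMeasure Ω m] fun p => f p.1 * UnitAddTorus.mFourier k p.2 :=
  coeFn_modulation _ _ k f

open scoped Classical in
theorem inner_tensor_of_hasSum {P : Freq m → Prop} {c : Freq m → L2 Ω}
    {W : Lp ℂ 2 (prodMeasure Ω m)}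
    (hW : HasSum (fun k : {k // P k} => tensor Ω k.1 (c k.1)) W) (k : Freq m) (f : L2 Ω) :
    ⟪tensor Ω k f, W⟫_ℂ = if P k then ⟪f, c k⟫_ℂ else 0 := by
  have h1 := hW.mapL (innerSL ℂ (tensor Ω k f))
  refine h1.unique ?_
  simp only [innerSL_apply_apply]
  split_ifs with h
  · have h2 := hasSum_single (f := fun k' : {k // P k} =>
      ⟪tensor Ω k f, tensor Ω k'.1 (c k'.1)⟫_ℂ) ⟨k, h⟩ fun k' hk' =>
        orthogonalFamily_tensor Ω (fun h' => hk' (Subtype.ext h'.symm)) f _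
    simpa only [LinearIsometry.inner_map_map] using h2
  · refine hasSum_zero.congr_fun fun k' => ?_
    exact orthogonalFamily_tensor Ω (fun h' : k = k'.1 => h (h' ▸ k'.2)) f _

variable {M : ∀ i, Matrix (Fin (m i)) (Fin d) ℝ}

/-- The `L²` norm of a vector field is at most the sum of those of its components, so componentwise
summability suffices. -/
theorem memL_of_hasSum {ℓ : Fin n} (c : FreqLevel m ℓ → L2 Ω)
    (W : Fin d → Lp ℂ 2 (prodMeasure Ω m))
    (hW : ∀ a, HasSum (fun k : FreqLevel m ℓ => tensor Ω k.1
      (((((M ℓ)ᵀ *ᵥ fun j => (k.1 ⟨ℓ, j⟩ : ℝ)) a : ℝ) : ℂ) • c k)) (W a)) :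
    MemL (𝕜 := ℂ) Ω M ℓ fun p => WithLp.toLp 2 fun a => W a p where
  memLp := MemLp.of_eval_piLp fun a => Lp.memLp (W a)
  exists_series := by
    refine ⟨fun k => c k, fun k => Lp.memLp (c k), ?_⟩
    have hterm : ∀ (a : Fin d) (s : Finset (FreqLevel m ℓ)),
        (fun p => (toComplex (WithLp.toLp 2 fun a => W a p : Vec ℂ d)
          - ∑ k ∈ s, fourierTerm M ℓ k.1 (c k) p) a) =ᵐ[prodMeasure Ω m]
        (W a - ∑ k ∈ s, tensor Ω k.1
          (((((M ℓ)ᵀ *ᵥ fun j => (k.1 ⟨ℓ, j⟩ : ℝ)) a : ℝ) : ℂ) • c k) :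
            Lp ℂ 2 (prodMeasure Ω m)) := by
      intro a s
      have h1 : ∀ᵐ p ∂(prodMeasure Ω m), ∀ k ∈ s, tensor Ω k.1
          (((((M ℓ)ᵀ *ᵥ fun j => (k.1 ⟨ℓ, j⟩ : ℝ)) a : ℝ) : ℂ) • c k) p =
            fourierTerm M ℓ k.1 (c k) p a := by
        refine (eventually_all_finset s).mpr fun k _ => ?_
        rw [map_smul]
        filter_upwards [Lp.coeFn_smul ((((M ℓ)ᵀ *ᵥ fun j => (k.1 ⟨ℓ, j⟩ : ℝ)) a : ℝ) : ℂ)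
            (tensor Ω k.1 (c k)), coeFn_tensor k.1 (c k)]
          with p hp hp'
        rw [hp, Pi.smul_apply, hp', fourierTerm, smul_eq_mul]
        ring
      filter_upwards [h1, Lp.coeFn_sub (W a) (∑ k ∈ s, tensor Ω k.1
          (((((M ℓ)ᵀ *ᵥ fun j => (k.1 ⟨ℓ, j⟩ : ℝ)) a : ℝ) : ℂ) • c k)),
        Lp.coeFn_finsetSum s fun k : FreqLevel m ℓ => tensor Ω k.1
          (((((M ℓ)ᵀ *ᵥ fun j => (k.1 ⟨ℓ, j⟩ : ℝ)) a : ℝ) : ℂ) • c k)] with p hp hp1 hp2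
      rw [hp1, Pi.sub_apply, hp2, Finset.sum_apply, Finset.sum_congr rfl hp]
      simp [toComplex]
    have hz : Tendsto (fun s : Finset (FreqLevel m ℓ) => ∑ a,
        eLpNorm (W a - ∑ k ∈ s, tensor Ω k.1
          (((((M ℓ)ᵀ *ᵥ fun j => (k.1 ⟨ℓ, j⟩ : ℝ)) a : ℝ) : ℂ) • c k) :
            Lp ℂ 2 (prodMeasure Ω m)) 2 (prodMeasure Ω m)) atTop (𝓝 0) := by
      have h0 : (0 : ℝ≥0∞) = ∑ _a : Fin d, 0 := Finset.sum_const_zero.symm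
      conv => enter [3]; rw [h0]
      refine tendsto_finsetSum _ fun a _ => ?_
      have h2 := (tendsto_const_nhds (x := W a)).sub (hW a)
      rw [sub_self] at h2
      simpa only [Lp.enorm_def, enorm_zero, SummationFilter.unconditional_filter] using h2.enorm
    refine tendsto_of_tendsto_of_tendsto_of_le_of_le tendsto_const_nhds hz
      (fun _ => zero_le) fun s => ?_
    refine (eLpNorm_vec_le_sum fun a => ?_).trans_eq
      (Finset.sum_congr rfl fun a _ => eLpNorm_congr_ae (hterm a s))
    exact (Lp.aestronglyMeasurable _).congr (hterm a s).symm

/-- The compactness theorem for complex-valued functions. -/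
theorem exists_multiscale_limit [NeZero n]
    [IsFiniteMeasure (volume.restrict (Ω : Set (Space d)))]
    (hM : ∀ i, NonDegenerate (M i)) {ε : ℕ → Fin n → ℝ} (hε : ScaleSeparated ε)
    {u : ℕ → Space d → ℂ} {G : ℕ → Space d → Vec ℂ d} (h : ∀ j, MemH1 Ω (u j) (G j))
    {C : ℝ≥0} (hC : ∀ j, h1Norm Ω (u j) (G j) ≤ C) :
    ∃ (φ : ℕ → ℕ) (u₀ : Space d → ℂ) (G₀ : Space d → Vec ℂ d)
      (U : Fin n → Space d × Torus m → Vec ℂ d),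
      StrictMono φ ∧ MemH1 Ω u₀ G₀ ∧ (∀ i, MemL Ω M i (U i)) ∧
      MultiscaleConverges Ω M (ε ∘ φ) (u ∘ φ) (fun p => u₀ p.1) ∧
      ∀ a : Fin d, MultiscaleConverges Ω M (ε ∘ φ) (fun k x => G (φ k) x a)
        (fun p => G₀ p.1 a + ∑ i, U i p a) := by
  classical
  have hu : ∀ j, ‖(h j).memLp.toLp (u j)‖ ≤ C := fun j => by
    rw [Lp.norm_toLp]
    exact ENNReal.toReal_le_coe_of_le_coe (le_self_add.trans (hC j))
  have hG : ∀ j a, ‖((h j).memLp_grad.eval_piLp a).toLp _‖ ≤ C := fun j a => by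
    rw [Lp.norm_toLp]
    refine ENNReal.toReal_le_coe_of_le_coe (le_trans ?_ (le_add_self.trans (hC j)))
    exact eLpNorm_mono fun x => PiLp.norm_apply_le (G j x) a
  have : Fact ((2 : ℝ≥0∞) ≠ ∞) := ⟨ENNReal.ofNat_ne_top⟩
  -- The index `none` carries the functions and `some a` their partial derivatives, so that a single
  -- subsequence serves all of them.
  obtain ⟨φ, hφ, c, hc, hsum⟩ := exists_subseq_coefficients (fun j => oscillation M Ω (ε j))
    (tendsto_inner_oscillation hε hM Ω)
    (fun j (i : Option (Fin d)) => i.elim ((h j).memLp.toLp (u j))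
      fun a => ((h j).memLp_grad.eval_piLp a).toLp _) C (by
        rintro j (_ | a)
        · exact hu j
        · exact hG j a)
  have hε' := hε.comp hφ
  have hcu := hc none
  have hcG := fun a => hc (some a)
  simp only [Option.elim] at hcu hcG
  have hu0 : ∀ k : Freq m, k ≠ 0 → c none k = 0 := fun k hk =>
    limit_coefficient_eq_zero (M := M) hε' hM (fun j => h (φ j)) (hcu k) (fun a => hcG a k) hk
  have hsum' : ∀ a, Summable fun k : Freq m => tensor Ω k (c (some a) k) := fun a =>
    ((orthogonalFamily_tensor Ω).summable_iff_norm_sq_summable _).mpr (hsum (some a))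
  let W : Fin n → Fin d → Lp ℂ 2 (prodMeasure Ω m) := fun ℓ a =>
    ∑' k : FreqLevel m ℓ, tensor Ω k.1 (c (some a) k.1)
  have hW : ∀ ℓ a, HasSum (fun k : FreqLevel m ℓ => tensor Ω k.1 (c (some a) k.1)) (W ℓ a) :=
    fun ℓ a => ((hsum' a).subtype _).hasSum
  refine ⟨φ, c none 0, fun x => WithLp.toLp 2 fun a => c (some a) 0 x,
    fun ℓ p => WithLp.toLp 2 fun a => W ℓ a p, hφ, ⟨Lp.memLp _,
      MemLp.of_eval_piLp fun a => Lp.memLp _,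
      hasWeakGradient_of_tendsto_inner (M := M) (ε := ε ∘ φ) (fun j => h (φ j)) (hcu 0)
        fun a => hcG a 0⟩, fun ℓ => ?_, ?_, fun a => ?_⟩
  · have hζ : ∀ k : FreqLevel m ℓ, ∃ b, ((M ℓ)ᵀ *ᵥ fun j => (k.1 ⟨ℓ, j⟩ : ℝ)) b ≠ 0 := fun k =>
      Function.ne_iff.mp (hM ℓ (fun j => k.1 ⟨ℓ, j⟩) (Function.ne_iff.mpr k.2.1))
    choose b hb using hζ
    -- The scalar coefficient is recovered by dividing the component `b k` of the limit by the
    -- nonzero component `b k` of `M_ℓᵀk_ℓ`; proportionality then gives the other components.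
    refine memL_of_hasSum (fun k =>
      ((((M ℓ)ᵀ *ᵥ fun j => (k.1 ⟨ℓ, j⟩ : ℝ)) (b k) : ℝ) : ℂ)⁻¹ • c (some (b k)) k.1) (W ℓ)
      fun a => ?_
    convert hW ℓ a using 3 with k
    rw [smul_comm, ← limit_grad_coefficient (M := M) hε' hM (fun j => h (φ j)) (hcu k)
      (fun a => hcG a k) k.2 a (b k), smul_smul,
      inv_mul_cancel₀ (Complex.ofReal_ne_zero.mpr (hb k)), one_smul]
  · have hw : (fun p : Space d × Torus m => c none 0 p.1) =ᵐ[prodMeasure Ω m]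
        tensor Ω 0 (c none 0) := by
      filter_upwards [coeFn_tensor (m := m) 0 (c none 0)] with p hp
      rw [hp, UnitAddTorus.mFourier_zero]
      simp
    have hw' := (Lp.memLp (tensor (m := m) Ω 0 (c none 0))).ae_eq hw.symm
    refine multiscaleConverges_of_tendsto_inner (fun j => (h (φ j)).memLp) (fun j => hu (φ j)) hw'
      fun k f => ?_
    rw [MemLp.toLp_congr hw' (Lp.memLp _) hw, Lp.toLp_coeFn]
    refine Eq.subst (motive := fun z => Tendsto _ atTop (𝓝 z)) (Eq.symm ?_) (hcu k f)
    by_cases hk : k = 0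
    · rw [hk, LinearIsometry.inner_map_map]
    · rw [hu0 k hk, inner_zero_right]
      exact orthogonalFamily_tensor Ω hk _ _
  · have hw : (fun p : Space d × Torus m => c (some a) 0 p.1 + ∑ ℓ, W ℓ a p)
        =ᵐ[prodMeasure Ω m]
        (tensor Ω 0 (c (some a) 0) + ∑ ℓ, W ℓ a : Lp ℂ 2 (prodMeasure Ω m)) := by
      filter_upwards [coeFn_tensor (m := m) 0 (c (some a) 0),
        Lp.coeFn_add (tensor Ω 0 (c (some a) 0)) (∑ ℓ, W ℓ a),
        Lp.coeFn_finsetSum Finset.univ fun ℓ => W ℓ a] with p hp hp1 hp2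
      rw [hp1, Pi.add_apply, hp, hp2, UnitAddTorus.mFourier_zero]
      simp
    have hw' := (Lp.memLp (tensor Ω 0 (c (some a) 0) + ∑ ℓ, W ℓ a)).ae_eq hw.symm
    refine multiscaleConverges_of_tendsto_inner
      (fun j => (h (φ j)).memLp_grad.eval_piLp a) (fun j => hG (φ j) a) hw' fun k f => ?_
    rw [MemLp.toLp_congr hw' (Lp.memLp _) hw, Lp.toLp_coeFn]
    refine Eq.subst (motive := fun z => Tendsto _ atTop (𝓝 z)) (Eq.symm ?_) (hcG a k f)
    rw [inner_add_right, inner_sum,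
      Finset.sum_congr rfl fun ℓ _ => inner_tensor_of_hasSum (hW ℓ a) k f]
    -- The zero frequency is seen only by the mean term, and a nonzero one by exactly one `W ℓ`,
    -- that of its level.
    by_cases hk : k = 0
    · rw [hk, LinearIsometry.inner_map_map, Finset.sum_eq_zero, add_zero]
      exact fun ℓ _ => if_neg fun h' => IsLevel.ne_zero h' rfl
    · obtain ⟨ℓ, hℓ⟩ := exists_isLevel hk
      rw [Finset.sum_eq_single ℓ, if_pos hℓ, orthogonalFamily_tensor Ω hk, zero_add]
      · exact fun i _ hi => if_neg fun h' => hi (IsLevel.unique h' hℓ)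
      · simp

end Limit

end CutProject

namespace CutProject

open scoped ComplexConjugate

/-! ### Comparing the scalar field with the complex numbers -/

section Scalars

variable {𝕜 : Type*} [RCLike 𝕜]

theorem map_complex_mul (x y : 𝕜) :
    RCLike.map 𝕜 ℂ (x * y) = RCLike.map 𝕜 ℂ x * RCLike.map 𝕜 ℂ y := by
  apply Complex.ext <;> simp

theorem norm_map_complex (x : 𝕜) : ‖RCLike.map 𝕜 ℂ x‖ = ‖x‖ := by
  rw [← sq_eq_sq₀ (norm_nonneg _) (norm_nonneg _), ← Complex.normSq_eq_norm_sq,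
    ← RCLike.normSq_eq_def', RCLike.normSq_apply, Complex.normSq_apply]
  simp

/-- `RCLike.map ℂ 𝕜` amounts to the real part if `I = 0` in `𝕜`, and to an isomorphism otherwise.
Either way it is linear over `𝕜`, which lets it pass through products with test functions. -/
theorem map_of_complex_mul (z : ℂ) (x : 𝕜) :
    RCLike.map ℂ 𝕜 (z * RCLike.map 𝕜 ℂ x) = RCLike.map ℂ 𝕜 z * x := by
  rcases RCLike.I_mul_I_ax (K := 𝕜) with h | h
  · have hx := RCLike.im_eq_zero h x
    conv_rhs => rw [← RCLike.re_add_im x]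
    simp [h, hx]
  · simp only [RCLike.map_apply]
    simp
    linear_combination (-(z.im : 𝕜) * (RCLike.im x : 𝕜)) * h +
      ((z.re : 𝕜) + z.im * RCLike.I) * RCLike.re_add_im x

theorem map_of_complex_map_complex (x : 𝕜) : RCLike.map ℂ 𝕜 (RCLike.map 𝕜 ℂ x) = x := by
  have h := map_of_complex_mul 1 x
  rw [one_mul] at h
  rw [h]
  simp

variable (𝕜) in
theorem map_complex_map_of_complex :
    (∀ z, RCLike.map 𝕜 ℂ (RCLike.map ℂ 𝕜 z) = z) ∨
      ∀ z, RCLike.map 𝕜 ℂ (RCLike.map ℂ 𝕜 z) = 2⁻¹ * (z + conj z) := by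
  rcases RCLike.I_eq_zero_or_im_I_eq_one (K := 𝕜) with h | h
  · right
    intro z
    apply Complex.ext <;> simp [h]
    ring
  · left
    intro z
    apply Complex.ext <;> simp [h]

variable {d : ℕ}

/-- The image in `𝕜` of a complex vector. -/
noncomputable def ofComplex (v : Vec ℂ d) : Vec 𝕜 d :=
  WithLp.toLp 2 fun a => RCLike.map ℂ 𝕜 (v a)

theorem norm_toComplex (v : Vec 𝕜 d) : ‖toComplex v‖ = ‖v‖ := by
  simp only [EuclideanSpace.norm_eq, toComplex, norm_map_complex]

end Scalars

/-! ### Transfer between the scalar field and the complex numbers -/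

section Transfer

variable {𝕜 : Type*} [RCLike 𝕜] {d n : ℕ} {m : Fin n → ℕ} {Ω : Opens (Space d)}

/-- The composition of a test function with a linear map. -/
noncomputable def mapTest {𝕜' : Type*} [RCLike 𝕜'] (A : 𝕜 →L[ℝ] 𝕜') (φ : TestFunction Ω 𝕜 ⊤) :
    TestFunction Ω 𝕜' ⊤ where
  toFun x := A (φ x)
  contDiff' := A.contDiff.comp φ.contDiff
  hasCompactSupport' := φ.hasCompactSupport.comp_left (map_zero A)
  tsupport_subset' := (closure_mono (Function.support_comp_subset (map_zero A) φ)).trans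
    φ.tsupport_subset

theorem grad_mapTest {𝕜' : Type*} [RCLike 𝕜'] (A : 𝕜 →L[ℝ] 𝕜') (φ : TestFunction Ω 𝕜 ⊤)
    (x : Space d) (a : Fin d) : grad (mapTest A φ) x a = A (grad φ x a) := by
  have h : HasFDerivAt φ (fderiv ℝ φ x) x :=
    (φ.contDiff.differentiable (by simp) x).hasFDerivAt
  change fderiv ℝ (fun y => A (φ y)) x _ = A (fderiv ℝ φ x _)
  have h' : HasFDerivAt (fun y => A (φ y)) (A.comp (fderiv ℝ φ x)) x := A.hasFDerivAt.comp x h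
  rw [h'.fderiv]
  rfl

theorem map_complex_mul_eq (x : 𝕜) (z : ℂ) :
    RCLike.map 𝕜 ℂ x * z = RCLike.map 𝕜 ℂ (x * (z.re : 𝕜)) +
      Complex.I * RCLike.map 𝕜 ℂ (x * (z.im : 𝕜)) := by
  have h : ∀ t : ℝ, RCLike.map 𝕜 ℂ (t : 𝕜) = t := fun t => by simp
  rw [map_complex_mul, map_complex_mul, h, h]
  conv_lhs => rw [← Complex.re_add_im z]
  ring

/-- A complex test function is tested through its real and imaginary parts, both admissible over
`𝕜`. -/
theorem integral_map_complex_mul {v : Space d → 𝕜} {f : Space d → ℂ}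
    (hv : MemLp v 2 (volume.restrict (Ω : Set (Space d))))
    (hf : MemLp f 2 (volume.restrict (Ω : Set (Space d)))) :
    ∫ x in (Ω : Set (Space d)), RCLike.map 𝕜 ℂ (v x) * f x =
      RCLike.map 𝕜 ℂ (∫ x in (Ω : Set (Space d)), v x * ((f x).re : 𝕜)) +
        Complex.I * RCLike.map 𝕜 ℂ (∫ x in (Ω : Set (Space d)), v x * ((f x).im : 𝕜)) := by
  have h1 : Integrable (fun x => v x * ((f x).re : 𝕜)) (volume.restrict (Ω : Set (Space d))) :=
    hv.integrable_mul ((RCLike.ofRealCLM (K := 𝕜)).comp_memLp' hf.re)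
  have h2 : Integrable (fun x => v x * ((f x).im : 𝕜)) (volume.restrict (Ω : Set (Space d))) :=
    hv.integrable_mul ((RCLike.ofRealCLM (K := 𝕜)).comp_memLp' hf.im)
  rw [← ContinuousLinearMap.integral_comp_comm _ h1, ← ContinuousLinearMap.integral_comp_comm _ h2,
    ← integral_const_mul, ← integral_add ((RCLike.map 𝕜 ℂ).integrable_comp h1)
      (((RCLike.map 𝕜 ℂ).integrable_comp h2).const_mul _)]
  exact integral_congr_ae (Eventually.of_forall fun x => map_complex_mul_eq _ _)

theorem MemH1.toComplex {u : Space d → 𝕜} {G : Space d → Vec 𝕜 d} (h : MemH1 Ω u G) :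
    MemH1 Ω (fun x => RCLike.map 𝕜 ℂ (u x)) fun x => CutProject.toComplex (G x) where
  memLp := (RCLike.map 𝕜 ℂ).comp_memLp' h.memLp
  memLp_grad := MemLp.of_eval_piLp fun a =>
    (RCLike.map 𝕜 ℂ).comp_memLp' (h.memLp_grad.eval_piLp a)
  hasWeakGradient := by
    intro φ a
    have h1 := h.hasWeakGradient (mapTest ((RCLike.ofRealCLM (K := 𝕜)).comp Complex.reCLM) φ) a
    have h2 := h.hasWeakGradient (mapTest ((RCLike.ofRealCLM (K := 𝕜)).comp Complex.imCLM) φ) a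
    simp only [grad_mapTest] at h1 h2
    change ∫ x in (Ω : Set (Space d)), RCLike.map 𝕜 ℂ (u x) * grad φ x a =
      -∫ x in (Ω : Set (Space d)), RCLike.map 𝕜 ℂ (G x a) * φ x
    rw [integral_map_complex_mul h.memLp (memLp_grad_testFunction φ a),
      integral_map_complex_mul (h.memLp_grad.eval_piLp a) (memLp_testFunction φ)]
    refine (congrArg₂ (fun s t => RCLike.map 𝕜 ℂ s + Complex.I * RCLike.map 𝕜 ℂ t) h1 h2).trans ?_
    simp only [map_neg]
    rw [mul_neg, ← neg_add]
    rfl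

theorem h1Norm_toComplex (u : Space d → 𝕜) (G : Space d → Vec 𝕜 d) :
    h1Norm Ω (fun x => RCLike.map 𝕜 ℂ (u x)) (fun x => toComplex (G x)) = h1Norm Ω u G := by
  unfold h1Norm
  congr 1
  · exact eLpNorm_congr_norm_ae (Eventually.of_forall fun x => norm_map_complex _)
  · exact eLpNorm_congr_norm_ae (Eventually.of_forall fun x => norm_toComplex _)

variable (𝕜) in
theorem MemH1.ofComplex {u : Space d → ℂ} {G : Space d → Vec ℂ d} (h : MemH1 Ω u G) :
    MemH1 Ω (fun x => RCLike.map ℂ 𝕜 (u x)) fun x => CutProject.ofComplex (G x) where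
  memLp := (RCLike.map ℂ 𝕜).comp_memLp' h.memLp
  memLp_grad := MemLp.of_eval_piLp fun a =>
    (RCLike.map ℂ 𝕜).comp_memLp' (h.memLp_grad.eval_piLp a)
  hasWeakGradient := by
    intro φ a
    have h1 := congrArg (RCLike.map ℂ 𝕜) (h.hasWeakGradient (mapTest (RCLike.map 𝕜 ℂ) φ) a)
    have hi : Integrable (fun x => u x * grad (mapTest (RCLike.map 𝕜 ℂ) φ) x a)
        (volume.restrict (Ω : Set (Space d))) :=
      h.memLp.integrable_mul (memLp_grad_testFunction _ a)
    have hi' : Integrable (fun x => G x a * mapTest (RCLike.map 𝕜 ℂ) φ x)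
        (volume.restrict (Ω : Set (Space d))) :=
      (h.memLp_grad.eval_piLp a).integrable_mul (memLp_testFunction _)
    rw [map_neg, ← ContinuousLinearMap.integral_comp_comm _ hi,
      ← ContinuousLinearMap.integral_comp_comm _ hi'] at h1
    refine Eq.trans (integral_congr_ae (Eventually.of_forall fun x => ?_)) (h1.trans
      (congrArg Neg.neg (integral_congr_ae (Eventually.of_forall fun x => ?_))))
    · simp only [grad_mapTest, map_of_complex_mul]
    · exact map_of_complex_mul _ _

variable {M : ∀ i, Matrix (Fin (m i)) (Fin d) ℝ}

theorem MultiscaleConverges.ofComplex {ε : ℕ → Fin n → ℝ} {v : ℕ → Space d → 𝕜}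
    {w : Space d × Torus m → ℂ} (hv : ∀ j, MemLp (v j) 2 (volume.restrict (Ω : Set (Space d))))
    (h : MultiscaleConverges Ω M ε (fun j x => RCLike.map 𝕜 ℂ (v j x)) w) :
    MultiscaleConverges Ω M ε v fun p => RCLike.map ℂ 𝕜 (w p) where
  memLp_seq := hv
  memLp_limit := (RCLike.map ℂ 𝕜).comp_memLp' h.memLp_limit
  tendsto ψ hψ := by
    let ψ' : Space d → C(Torus m, ℂ) := fun x =>
      (RCLike.map 𝕜 ℂ).compLeftContinuous ℝ (Torus m) (ψ x)
    have hψ' : MemLp ψ' 2 (volume.restrict (Ω : Set (Space d))) :=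
      ((RCLike.map 𝕜 ℂ).compLeftContinuous ℝ (Torus m)).comp_memLp' hψ
    have h1 := ((RCLike.map ℂ 𝕜).continuous.tendsto _).comp (h.tendsto ψ' hψ')
    have hi : Integrable (fun p : Space d × Torus m => w p * ψ' p.1 p.2) (prodMeasure Ω m) :=
      h.memLp_limit.integrable_mul
        (memLp_eval (measurePreserving_fst_prodMeasure Ω) measurable_snd hψ')
    rw [← ContinuousLinearMap.integral_comp_comm _ hi] at h1
    have h2 : ∀ p : Space d × Torus m, RCLike.map ℂ 𝕜 (w p * ψ' p.1 p.2) =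
        RCLike.map ℂ 𝕜 (w p) * ψ p.1 p.2 := fun p => map_of_complex_mul _ _
    simp only [h2] at h1
    refine h1.congr fun j => ?_
    have hj : Integrable (fun x => RCLike.map 𝕜 ℂ (v j x) * ψ' x (cutProj M (ε j) x))
        (volume.restrict (Ω : Set (Space d))) :=
      (h.memLp_seq j).integrable_mul
        (memLp_eval (MeasurePreserving.id _) (continuous_cutProj M (ε j)).measurable hψ')
    rw [Function.comp_apply, ← ContinuousLinearMap.integral_comp_comm _ hj]
    refine integral_congr_ae (Eventually.of_forall fun x => ?_)
    change RCLike.map ℂ 𝕜 (RCLike.map 𝕜 ℂ (v j x) *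
      RCLike.map 𝕜 ℂ (ψ x (cutProj M (ε j) x))) = _
    rw [map_of_complex_mul, map_of_complex_map_complex]

/-- The negative of a frequency at the level `ℓ`. -/
def negLevel {ℓ : Fin n} (k : FreqLevel m ℓ) : FreqLevel m ℓ :=
  ⟨-k.1, by simpa using k.2⟩

theorem negLevel_involutive {ℓ : Fin n} :
    Function.Involutive (negLevel : FreqLevel m ℓ → FreqLevel m ℓ) :=
  fun k => Subtype.ext (neg_neg k.1)

/-- The entrywise conjugate of a vector. -/
noncomputable def conjVec (v : Vec ℂ d) : Vec ℂ d := WithLp.toLp 2 fun a => conj (v a)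

theorem norm_conjVec (v : Vec ℂ d) : ‖conjVec v‖ = ‖v‖ := by
  simp [EuclideanSpace.norm_eq, conjVec]

theorem conjVec_sub_sum {ι : Type*} (v : Vec ℂ d) (s : Finset ι) (f : ι → Vec ℂ d) :
    conjVec (v - ∑ k ∈ s, f k) = conjVec v - ∑ k ∈ s, conjVec (f k) := by
  ext a
  simp [conjVec]

/-- Conjugation reverses the frequency of the exponential but not the sign of the real vector
`M_ℓᵀk_ℓ`, hence the minus sign in the coefficient. -/
theorem conjVec_fourierTerm (ℓ : Fin n) (k : Freq m) (c : Space d → ℂ)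
    (p : Space d × Torus m) :
    conjVec (fourierTerm M ℓ (-k) c p) = fourierTerm M ℓ k (fun x => -conj (c x)) p := by
  ext a
  have h : ((M ℓ)ᵀ *ᵥ fun j => ((-k ⟨ℓ, j⟩ : ℤ) : ℝ)) =
      -((M ℓ)ᵀ *ᵥ fun j => (k ⟨ℓ, j⟩ : ℝ)) := by
    rw [← Matrix.mulVec_neg]
    congr 1
    ext j
    simp
  simp only [conjVec, fourierTerm, UnitAddTorus.mFourier_neg, map_mul, Pi.neg_apply, h,
    Complex.conj_conj, Complex.conj_ofReal, Complex.ofReal_neg, map_neg]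
  ring

theorem fourierTerm_half_add (ℓ : Fin n) (k : Freq m) (f g : Space d → ℂ)
    (p : Space d × Torus m) :
    fourierTerm M ℓ k (fun x => 2⁻¹ * (f x + g x)) p =
      (2⁻¹ : ℂ) • (fourierTerm M ℓ k f p + fourierTerm M ℓ k g p) := by
  ext a
  simp only [fourierTerm, PiLp.smul_apply, PiLp.add_apply, smul_eq_mul]
  ring

theorem memLp_fourierTerm (ℓ : Fin n) (k : Freq m) {c : Space d → ℂ}
    (hc : MemLp c 2 (volume.restrict (Ω : Set (Space d)))) :
    MemLp (fourierTerm M ℓ k c) 2 (prodMeasure Ω m) := by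
  refine MemLp.of_eval_piLp fun a => ?_
  have h := (memLp_comp_mul (measurePreserving_fst_prodMeasure (m := m) Ω)
    (g := fun p => UnitAddTorus.mFourier k p.2)
    ((UnitAddTorus.mFourier k).continuous.measurable.comp measurable_snd).aestronglyMeasurable
    (fun p => norm_mFourier_apply k p.2) hc).const_mul
      ((((M ℓ)ᵀ *ᵥ fun j => (k ⟨ℓ, j⟩ : ℝ)) a : ℝ) : ℂ)
  refine h.ae_eq (Eventually.of_forall fun p => ?_)
  simp only [fourierTerm]
  ring

variable (𝕜) in
theorem MemL.ofComplex {ℓ : Fin n} {w : Space d × Torus m → Vec ℂ d} (h : MemL Ω M ℓ w) :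
    MemL Ω M ℓ fun p => (CutProject.ofComplex (w p) : Vec 𝕜 d) where
  memLp := MemLp.of_eval_piLp fun a => (RCLike.map ℂ 𝕜).comp_memLp' (h.memLp.eval_piLp a)
  exists_series := by
    have hid : ∀ v : Vec ℂ d, CutProject.toComplex v = v := fun v => by
      ext a
      simp [CutProject.toComplex]
    obtain ⟨c, hc, hlim⟩ := h.exists_series
    simp only [hid] at hlim
    rcases map_complex_map_of_complex 𝕜 with hπ | hπ
    · refine ⟨c, hc, ?_⟩
      have : ∀ v : Vec ℂ d, CutProject.toComplex (CutProject.ofComplex v : Vec 𝕜 d) = v :=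
        fun v => by
          ext a
          exact hπ _
      simpa only [this] using hlim
    · classical
      -- Here the projection is the real part `(w + conj w)/2`. Conjugating the series of `w` and
      -- substituting `-k` for `k` gives the coefficients of `conj w`.
      refine ⟨fun k x => 2⁻¹ * (c k x + -conj (c (negLevel k) x)), fun k =>
        ((hc k).add (hc (negLevel k)).star.neg).const_mul _, ?_⟩
      let D : Finset (FreqLevel m ℓ) → Space d × Torus m → Vec ℂ d := fun s p =>
        w p - ∑ k ∈ s, fourierTerm M ℓ k.1 (c k) p
      have hD : ∀ s, AEStronglyMeasurable (D s) (prodMeasure Ω m) := fun s =>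
        (h.memLp.sub (memLp_finsetSum s fun k _ => memLp_fourierTerm ℓ k.1 (hc k))).1
      -- Negation permutes the frequencies of level `ℓ`, so the reflected partial sums converge
      -- along the same net.
      have hneg : Tendsto (fun s : Finset (FreqLevel m ℓ) =>
          eLpNorm (D (s.image negLevel)) 2 (prodMeasure Ω m)) atTop (𝓝 0) := hlim.comp (tendsto_finset_image_atTop_atTop negLevel_involutive)
      have hsum := Tendsto.add hlim hneg
      rw [add_zero] at hsum
      refine tendsto_of_tendsto_of_tendsto_of_le_of_le tendsto_const_nhds hsum
        (fun _ => zero_le) fun s => ?_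
      have key : ∀ p, CutProject.toComplex (CutProject.ofComplex (w p) : Vec 𝕜 d) -
          ∑ k ∈ s, fourierTerm M ℓ k.1
            (fun x => 2⁻¹ * (c k x + -conj (c (negLevel k) x))) p =
          (2⁻¹ : ℂ) • (D s p + conjVec (D (s.image negLevel) p)) := by
        intro p
        have h1 : conjVec (D (s.image negLevel) p) = conjVec (w p) -
            ∑ k ∈ s, fourierTerm M ℓ k.1 (fun x => -conj (c (negLevel k) x)) p := by
          simp only [D, conjVec_sub_sum]
          rw [Finset.sum_image negLevel_involutive.injective.injOn]
          congr 1
          exact Finset.sum_congr rfl fun k _ => conjVec_fourierTerm ℓ k.1 _ p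
        have h2 : CutProject.toComplex (CutProject.ofComplex (w p) : Vec 𝕜 d) =
            (2⁻¹ : ℂ) • (w p + conjVec (w p)) := by
          ext a
          exact hπ _
        simp only [h1, h2, fourierTerm_half_add, ← Finset.smul_sum, ← smul_sub,
          Finset.sum_add_distrib, D]
        congr 1
        abel
      refine (eLpNorm_mono_real (g := fun p => ‖D s p‖ + ‖D (s.image negLevel) p‖)
        fun p => ?_).trans ((eLpNorm_add_le (hD s).norm (hD _).norm (by norm_num)).trans_eq ?_)
      · rw [key, norm_smul]
        have h2 := norm_add_le (D s p) (conjVec (D (s.image negLevel) p))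
        rw [norm_conjVec] at h2
        have h3 : ‖(2⁻¹ : ℂ)‖ = 2⁻¹ := by norm_num
        rw [h3]
        linarith [norm_nonneg (D s p + conjVec (D (s.image negLevel) p))]
      · rw [eLpNorm_norm, eLpNorm_norm]

end Transfer

end CutProject

theorem theorem5 {𝕜 : Type*} [RCLike 𝕜] {d n : ℕ} [NeZero n] {m : Fin n → ℕ}
    (Ω : TopologicalSpace.Opens (CutProject.Space d))
    (hΩ : Bornology.IsBounded (Ω : Set (CutProject.Space d)))
    (M : ∀ i, Matrix (Fin (m i)) (Fin d) ℝ) (hM : ∀ i, CutProject.NonDegenerate (M i))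
    (ε : ℕ → Fin n → ℝ) (hε : CutProject.ScaleSeparated ε)
    (u : ℕ → CutProject.Space d → 𝕜) (Du : ℕ → CutProject.Space d → CutProject.Vec 𝕜 d)
    (hu : ∀ k, CutProject.MemH10 Ω (u k) (Du k))
    (hbdd : ∃ C : ℝ≥0, ∀ k, CutProject.h1Norm Ω (u k) (Du k) ≤ C) :
    ∃ (φ : ℕ → ℕ) (u₀ : CutProject.Space d → 𝕜) (Du₀ : CutProject.Space d → CutProject.Vec 𝕜 d)
      (U : Fin n → CutProject.Space d × CutProject.Torus m → CutProject.Vec 𝕜 d),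
      StrictMono φ ∧
      CutProject.MemH1 Ω u₀ Du₀ ∧
      (∀ i, CutProject.MemL Ω M i (U i)) ∧
      CutProject.MultiscaleConverges Ω M (ε ∘ φ) (u ∘ φ) (fun p => u₀ p.1) ∧
      ∀ a : Fin d, CutProject.MultiscaleConverges Ω M (ε ∘ φ) (fun k x => Du (φ k) x a)
        (fun p => Du₀ p.1 a + ∑ i, U i p a) := by
  obtain ⟨C, hC⟩ := hbdd
  -- Boundedness of `Ω` puts `L²(Ω)` inside `L¹(Ω)`, as the totality of test functions in
  -- `eq_zero_of_inner_conjTest` requires.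
  have : IsFiniteMeasure (volume.restrict (Ω : Set (CutProject.Space d))) :=
    ⟨by simpa using hΩ.measure_lt_top⟩
  obtain ⟨φ, u₀, G₀, U, hφ, h0, hU, h1, h2⟩ := CutProject.exists_multiscale_limit hM hε
    (fun j => (hu j).toMemH1.toComplex)
    (fun j => (CutProject.h1Norm_toComplex (u j) (Du j)).le.trans (hC j))
  refine ⟨φ, fun x => RCLike.map ℂ 𝕜 (u₀ x), fun x => CutProject.ofComplex (G₀ x),
    fun i p => CutProject.ofComplex (U i p), hφ, h0.ofComplex 𝕜, fun i => (hU i).ofComplex 𝕜,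
    CutProject.MultiscaleConverges.ofComplex (fun j => (hu (φ j)).memLp) h1, fun a => ?_⟩
  have h3 := CutProject.MultiscaleConverges.ofComplex
    (fun j => (hu (φ j)).memLp_grad.eval_piLp a) (h2 a)
  simpa only [map_add, map_sum, CutProject.ofComplex] using h3
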